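/- Let $A\in\mathbb R^{m\times n}$, $G\in\mathbb R^{l\times n}$, and consider the problem $$\min f(x)\quad\text{subject to } Ax=b,\ x\in P=\{x\in\mathbb R^n : Gx\preceq h\},\qquad(1.1)$$ where the feasible set $\{x\in P: Ax=b\}$ is nonempty, $f:\mathbb R^n\to\mathbb R$ is differentiable, $\|\nabla f(x)-\nabla f(x')\|\le L_f\|x-x'\|$ for all $x,x'\in P$ (with $L_f\ge 0$), and $f(x)>\underline f$ for all feasible $x$, where $\underline f\in\mathbb R$. For $\rho\ge0$ and $p>0$ put $$K(x,z;y)=f(x)+y^T(Ax-b)+\tfrac{\rho}{2}\|Ax-b\|^2+\tfrac p2\|x-z\|^2 .$$ The S-prox-ALM with parameters $c,\alpha,\beta>0$ starts from arbitrary $x^0,z^0\in\mathbb R^n$, $y^0\in\mathbb R^m$ and iterates $$y^{t+1}=y^t+\alpha(Ax^t-b),\quad x^{t+1}=\mathrm{proj}_P\bigl(x^t-c\nabla_xK(x^t,z^t;y^{t+1})\bigr),\quad z^{t+1}=z^t+\beta(x^{t+1}-z^t).$$ A pair $(x,y)$ is a KKT point of (1.1) if there is $\mu\succeq0$ in $\mathbb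 R^l$ with $\nabla f(x)+A^Ty+G^T\mu=0$, $Ax=b$, $Gx\preceq h$ and $\mu_i(Gx-h)_i=0$ for all $i$. It is an $\epsilon$-stationary solution if $\|Ax-b\|\le\epsilon$ and some $v\in\nabla f(x)+A^Ty+\partial\iota(x)$ has $\|v\|\le\epsilon$, where $\iota$ is the indicator function of $P$ ($0$ on $P$, $+\infty$ elsewhere) and $\partial\iota$ its subdifferential. Finally let $$\phi^0=K(x^0,z^0;y^0)-2\min_{x\in P}K(x,z^0;y^0)+2\min_{x\in P,\,Ax=b}\bigl\{f(x)+\tfrac p2\|x-z^0\|^2\bigr\}.$$ **Theorem.** Let $p\ge3L_f$, $p>L_f$, $\rho\ge0$ and $0<c<1/(L_f+\rho\sigma_{\max}^2(A)+p)$, where $\sigma_{\max}(A)$ is the largest singular value of $A$. Then there are $\alpha'>0$ and $\theta>0$, depending only on $L_f,A,G,p,\rho,c$, such that for all $0<\alpha<\alpha'$ and all $0<\beta<\beta':=\theta\alpha$ the following hold. 1. Every limit point of the sequence $\{(x^t,y^t)\}$ generated by the S-prox-ALM is a KKT point of (1.1). 2. There is a constant $B>0$ such that for every integer $t>0$ there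 is $s\in\{0,1,\dots,t-1\}$ for which $(x^{s+1},y^{s+1})$ is a $\sqrt B/\sqrt t$-stationary solution of (1.1); and for every $\epsilon>0$ there is an integer $0\le s<B/\epsilon^2$ for which $(x^{s+1},y^{s+1})$ is an $\epsilon$-stationary solution. If $x^0\in P$, one can take $B=\kappa\,(\phi^0-\underline f)$, where $\kappa>0$ depends only on $p,\rho,c,\alpha,\beta,L_f,A,G$. -/

import Mathlib

open Filter Topology

namespace SProxALM

noncomputable section

/-- Euclidean space `ℝⁿ`. -/
abbrev Vec (n : ℕ) : Type := EuclideanSpace ℝ (Fin n)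

/-- The matrix-vector product `M x`, as a map of Euclidean spaces. -/
abbrev mulV {m n : ℕ} (M : Matrix (Fin m) (Fin n) ℝ) (x : Vec n) : Vec m :=
  Matrix.toEuclideanLin M x

/-- The largest singular value of `M` (singular values are listed in decreasing order from
index `0`; the value is `0` when `M` has no columns). -/
def sigmaMax {m n : ℕ} (M : Matrix (Fin m) (Fin n) ℝ) : ℝ :=
  (Matrix.toEuclideanLin M).singularValues 0

/-- The polyhedral set `P = {x | G x ≤ h}` (componentwise). -/
def polyhedron {n l : ℕ} (G : Matrix (Fin l) (Fin n) ℝ) (h : Vec l) : Set (Vec n) :=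
  {x | ∀ i, mulV G x i ≤ h i}

/-- The feasible set `{x ∈ P | A x = b}`. -/
def feasibleSet {n m l : ℕ} (A : Matrix (Fin m) (Fin n) ℝ) (b : Vec m)
    (G : Matrix (Fin l) (Fin n) ℝ) (h : Vec l) : Set (Vec n) :=
  {x | x ∈ polyhedron G h ∧ mulV A x = b}

/-- `w` is a projection of `v` onto `S`: a nearest point of `S` in the Euclidean norm. -/
def IsProjOn {n : ℕ} (S : Set (Vec n)) (v w : Vec n) : Prop :=
  w ∈ S ∧ ∀ u ∈ S, ‖v - w‖ ≤ ‖v - u‖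

/-- The augmented Lagrangian `L_ρ(x; y) = f(x) + yᵀ(Ax - b) + (ρ/2)‖Ax - b‖²`. -/
def augLag {n m : ℕ} (f : Vec n → ℝ) (A : Matrix (Fin m) (Fin n) ℝ) (b : Vec m) (ρ : ℝ)
    (x : Vec n) (y : Vec m) : ℝ :=
  f x + inner ℝ y (mulV A x - b) + ρ / 2 * ‖mulV A x - b‖ ^ 2

/-- The proximal augmented Lagrangian `K(x, z; y) = L_ρ(x; y) + (p/2)‖x - z‖²`. -/
def proxLag {n m : ℕ} (f : Vec n → ℝ) (A : Matrix (Fin m) (Fin n) ℝ) (b : Vec m) (ρ p : ℝ)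
    (x z : Vec n) (y : Vec m) : ℝ :=
  augLag f A b ρ x y + p / 2 * ‖x - z‖ ^ 2

/-- The sequences `x, y, z` are generated by the S-prox-ALM, from arbitrary initial points. -/
structure IsSProxALM {n m l : ℕ} (f : Vec n → ℝ) (A : Matrix (Fin m) (Fin n) ℝ) (b : Vec m)
    (G : Matrix (Fin l) (Fin n) ℝ) (h : Vec l) (ρ p c α β : ℝ)
    (x : ℕ → Vec n) (y : ℕ → Vec m) (z : ℕ → Vec n) : Prop where
  y_step : ∀ t, y (t + 1) = y t + α • (mulV A (x t) - b)
  x_step : ∀ t, IsProjOn (polyhedron G h)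
    (x t - c • gradient (fun u => proxLag f A b ρ p u (z t) (y (t + 1))) (x t)) (x (t + 1))
  z_step : ∀ t, z (t + 1) = z t + β • (x (t + 1) - z t)

/-- `(x, y)` is a KKT point of `min f(x)` subject to `A x = b`, `G x ≤ h`. -/
def IsKKTPoint {n m l : ℕ} (f : Vec n → ℝ) (A : Matrix (Fin m) (Fin n) ℝ) (b : Vec m)
    (G : Matrix (Fin l) (Fin n) ℝ) (h : Vec l) (x : Vec n) (y : Vec m) : Prop :=
  ∃ μ : Vec l,
    gradient f x + mulV A.transpose y + mulV G.transpose μ = 0 ∧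
    mulV A x - b = 0 ∧
    (∀ i, mulV G x i ≤ h i) ∧
    (∀ i, 0 ≤ μ i) ∧
    (∀ i, μ i * (mulV G x i - h i) = 0)

open Classical in
/-- The indicator function of convex analysis: `0` on `S` and `+∞` off `S`. -/
def indicatorFn {n : ℕ} (S : Set (Vec n)) (x : Vec n) : EReal :=
  if x ∈ S then 0 else ⊤

/-- The subdifferential of an extended-real-valued function (empty where the function
is `+∞`). -/
def subdiff {n : ℕ} (g : Vec n → EReal) (x : Vec n) : Set (Vec n) :=
  {w | g x ≠ ⊤ ∧ ∀ u, g x + ((inner ℝ w (u - x) : ℝ) : EReal) ≤ g u}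

/-- `(x, y)` is an `ε`-stationary solution: `‖A x - b‖ ≤ ε`, and some
`v ∈ ∇f(x) + Aᵀ y + ∂ι(x)` has `‖v‖ ≤ ε`, where `ι` is the indicator function of `P`. -/
def IsEpsStationary {n m l : ℕ} (f : Vec n → ℝ) (A : Matrix (Fin m) (Fin n) ℝ) (b : Vec m)
    (G : Matrix (Fin l) (Fin n) ℝ) (h : Vec l) (ε : ℝ) (x : Vec n) (y : Vec m) : Prop :=
  ‖mulV A x - b‖ ≤ ε ∧
  ∃ w ∈ subdiff (indicatorFn (polyhedron G h)) x,
    ‖gradient f x + mulV A.transpose y + w‖ ≤ ε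

/-- The dual function `d(y, z) = min_{x ∈ P} K(x, z; y)`. -/
def dualFn {n m l : ℕ} (f : Vec n → ℝ) (A : Matrix (Fin m) (Fin n) ℝ) (b : Vec m)
    (G : Matrix (Fin l) (Fin n) ℝ) (h : Vec l) (ρ p : ℝ) (y : Vec m) (z : Vec n) : ℝ :=
  sInf ((fun x => proxLag f A b ρ p x z y) '' polyhedron G h)

/-- The proximal function `P(z) = min_{x ∈ P, A x = b} {f(x) + (p/2)‖x - z‖²}`. -/
def proxFn {n m l : ℕ} (f : Vec n → ℝ) (A : Matrix (Fin m) (Fin n) ℝ) (b : Vec m)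
    (G : Matrix (Fin l) (Fin n) ℝ) (h : Vec l) (p : ℝ) (z : Vec n) : ℝ :=
  sInf ((fun x => f x + p / 2 * ‖x - z‖ ^ 2) '' feasibleSet A b G h)

/-- The potential function `φ(x, y, z) = K(x, z; y) - 2 d(y, z) + 2 P(z)`. -/
def potential {n m l : ℕ} (f : Vec n → ℝ) (A : Matrix (Fin m) (Fin n) ℝ) (b : Vec m)
    (G : Matrix (Fin l) (Fin n) ℝ) (h : Vec l) (ρ p : ℝ)
    (x : Vec n) (y : Vec m) (z : Vec n) : ℝ :=
  proxLag f A b ρ p x z y - 2 * dualFn f A b G h ρ p y z + 2 * proxFn f A b G h p z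

end

end SProxALM

/-!
Let `X` and `Y` be the minimizers of `K(·, z; y)` over `P` and over the feasible set, and let
`φ(x, y, z) = K(x, z; y) - 2 d(y, z) + 2 P(z)`. In one iteration a projected gradient step decreases
`K`, the dual step increases `d` by about `α ‖A X - b‖²`, and the motion of the center `z` changes
`φ` by terms governed by `⟪x' - z, X - Y⟫`. These are absorbed, for small `α` and `β`, by the
decrease thanks to the error bounds `‖x' - X‖ ≤ σ ‖x - x'‖` (strong convexity of `K`) and
`‖X - Y‖ ≤ τ ‖A X - b‖`. The latter comes from the fact that projections onto the slices
`{x ∈ P | A x = d}` are Lipschitz in `d`, a consequence of Carathéodory's theorem for the finitely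
generated normal cones of a polyhedron. Hence `φ`, which is bounded below by the values of `f`,
decreases by a multiple of the squared stationarity residual; the residuals are square summable,
which gives both the rate and the convergence of subsequences.
-/

namespace SProxALM

section NormalCone

variable {E : Type*} [NormedAddCommGroup E] [InnerProductSpace ℝ E] {S T : Set E} {u u' q : E}

/-- The normal cone of `S` at `u`, the set of solutions of the variational inequality that
expresses first-order optimality. By convention it is empty when `u ∉ S`. -/
def normalCone (S : Set E) (u : E) : Set E :=
  {q | u ∈ S ∧ ∀ v ∈ S, inner ℝ q (v - u) ≤ 0}

theorem smul_mem_normalCone {r : ℝ} (hr : 0 ≤ r) (hq : q ∈ normalCone S u) :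
    r • q ∈ normalCone S u := by
  refine ⟨hq.1, fun v hv => ?_⟩
  rw [real_inner_smul_left]
  exact mul_nonpos_of_nonneg_of_nonpos hr (hq.2 v hv)

theorem normalCone_anti (hST : S ⊆ T) (hu : u ∈ S) : normalCone T u ⊆ normalCone S u :=
  fun _ hq => ⟨hu, fun v hv => hq.2 v (hST hv)⟩

theorem mem_normalCone_of_tendsto {α : Type*} {l : Filter α} [l.NeBot] (hS : IsClosed S)
    {x w : α → E} (hx : Tendsto x l (𝓝 u)) (hw : Tendsto w l (𝓝 q))
    (hmem : ∀ a, w a ∈ normalCone S (x a)) : q ∈ normalCone S u :=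
  ⟨hS.mem_of_tendsto hx (Eventually.of_forall fun a => (hmem a).1), fun v hv =>
    le_of_tendsto' (hw.inner (tendsto_const_nhds.sub hx)) fun a => (hmem a).2 v hv⟩

theorem mul_norm_sub_le_of_mem_normalCone {μ : ℝ} {e q' : E} (hq : e - q ∈ normalCone S u)
    (hq' : -q' ∈ normalCone S u') (hmono : μ * ‖u - u'‖ ^ 2 ≤ inner ℝ (q - q') (u - u')) :
    μ * ‖u - u'‖ ≤ ‖e‖ := by
  have hvi : inner ℝ (q - q') (u - u') ≤ inner ℝ e (u - u') := by
    have h₁ := hq.2 u' hq'.1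
    have h₂ := hq'.2 u hq.1
    rw [← neg_sub u u', inner_neg_right, inner_sub_left] at h₁
    rw [inner_neg_left] at h₂
    rw [inner_sub_left]
    linarith
  rcases (norm_nonneg (u - u')).eq_or_lt with h0 | h0
  · rw [← h0, mul_zero]
    exact norm_nonneg e
  · refine le_of_mul_le_mul_right ?_ h0
    calc μ * ‖u - u'‖ * ‖u - u'‖ = μ * ‖u - u'‖ ^ 2 := by ring
      _ ≤ inner ℝ e (u - u') := hmono.trans hvi
      _ ≤ ‖e‖ * ‖u - u'‖ := real_inner_le_norm _ _

theorem norm_sub_le_of_sub_mem_normalCone {w w' : E} (hu : w - u ∈ normalCone S u)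
    (hu' : w' - u' ∈ normalCone S u') : ‖u - u'‖ ≤ ‖w - w'‖ := by
  have h := mul_norm_sub_le_of_mem_normalCone (μ := 1) (e := w - w') (q := u - w') (q' := u' - w')
    (by rwa [sub_sub_sub_cancel_right]) (by rwa [neg_sub])
    (by rw [sub_sub_sub_cancel_right, real_inner_self_eq_norm_sq, one_mul])
  rwa [one_mul] at h

theorem eq_of_sub_mem_normalCone {w : E} (hu : w - u ∈ normalCone S u)
    (hu' : w - u' ∈ normalCone S u') : u = u' := by
  simpa [sub_eq_zero] using norm_sub_le_of_sub_mem_normalCone hu hu'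

theorem sub_mem_normalCone_of_forall_norm_le {w : E} (hS : Convex ℝ S) (hu : u ∈ S)
    (hmin : ∀ v ∈ S, ‖w - u‖ ≤ ‖w - v‖) : w - u ∈ normalCone S u := by
  have : Nonempty S := ⟨⟨u, hu⟩⟩
  refine ⟨hu, (norm_eq_iInf_iff_real_inner_le_zero hS hu).1 (le_antisymm ?_ ?_)⟩
  · exact le_ciInf fun v => hmin v v.2
  · exact ciInf_le ⟨0, by rintro _ ⟨v, rfl⟩; exact norm_nonneg _⟩ (⟨u, hu⟩ : S)

theorem exists_sub_mem_normalCone [CompleteSpace E] (hne : S.Nonempty) (hcl : IsClosed S)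
    (hS : Convex ℝ S) (w : E) : ∃ u, w - u ∈ normalCone S u := by
  obtain ⟨u, hu, hmin⟩ := exists_norm_eq_iInf_of_complete_convex hne hcl.isComplete hS w
  exact ⟨u, hu, (norm_eq_iInf_iff_real_inner_le_zero hS hu).1 hmin⟩

theorem neg_mem_normalCone_of_isMinOn [CompleteSpace E] {F : E → ℝ} (hS : Convex ℝ S) (hu : u ∈ S)
    (hF : HasGradientAt F q u) (hmin : IsMinOn F S u) : -q ∈ normalCone S u := by
  refine ⟨hu, fun v hv => ?_⟩
  have h := hmin.localize.hasFDerivWithinAt_nonneg hF.hasFDerivAt.hasFDerivWithinAt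
    (sub_mem_posTangentConeAt_of_segment_subset (hS.segment_subset hu hv))
  rw [inner_neg_left, neg_nonpos]
  simpa using h

end NormalCone

section Cone

variable {ι E : Type*} [NormedAddCommGroup E]

theorem mem_hull_image_finset_iff [Module ℝ E] {g : ι → E} {s : Finset ι} {q : E} :
    q ∈ PointedCone.hull ℝ (g '' s) ↔ ∃ μ : ι → ℝ, (∀ i, 0 ≤ μ i) ∧ ∑ i ∈ s, μ i • g i = q := by
  classical
  rw [PointedCone.hull, Submodule.mem_span_image_finset_iff_exists_fun]
  constructor
  · rintro ⟨c, hc⟩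
    refine ⟨fun i => if hi : i ∈ s then c ⟨i, hi⟩ else 0, fun i => ?_, ?_⟩
    · dsimp only
      split_ifs
      exacts [(c _).2, le_rfl]
    · rw [← hc, ← Finset.sum_coe_sort]
      exact Finset.sum_congr rfl fun i _ => by simp
  · rintro ⟨μ, hμ, rfl⟩
    exact ⟨fun i => ⟨μ i, hμ i⟩, Finset.sum_coe_sort s fun i => μ i • g i⟩

-- Subtract the largest multiple of the dependence `w` that keeps all coefficients nonnegative.
theorem hull_image_subset_iUnion_erase [Module ℝ E] [DecidableEq ι] {g : ι → E} {s : Finset ι}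
    {w : ι → ℝ} (hw : ∑ i ∈ s, w i • g i = 0) {j : ι} (hj : j ∈ s) (hwj : 0 < w j) :
    (PointedCone.hull ℝ (g '' s) : Set E) ⊆
      ⋃ i ∈ s, (PointedCone.hull ℝ (g '' (s.erase i : Finset ι)) : Set E) := by
  intro q hq
  obtain ⟨μ, hμ, rfl⟩ := mem_hull_image_finset_iff.1 hq
  obtain ⟨k, hk, hkmin⟩ := Finset.exists_min_image (s.filter fun i => 0 < w i)
    (fun i => μ i / w i) ⟨j, by simp [hj, hwj]⟩
  simp only [Finset.mem_filter] at hk hkmin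
  set ν : ι → ℝ := fun i => μ i - μ k / w k * w i with hν
  have hν0 : ∀ i ∈ s, 0 ≤ ν i := by
    intro i hi
    rcases le_or_gt (w i) 0 with h0 | h0
    · have := mul_nonpos_of_nonneg_of_nonpos (div_nonneg (hμ k) hk.2.le) h0
      linarith [hμ i]
    · have := (le_div_iff₀ h0).1 (hkmin i ⟨hi, h0⟩)
      linarith
  have hνk : ν k = 0 := by rw [hν]; field_simp [hk.2.ne']; ring
  have hsum : ∑ i ∈ s, ν i • g i = ∑ i ∈ s, μ i • g i := by
    simp only [hν, sub_smul, mul_smul, Finset.sum_sub_distrib, ← Finset.smul_sum, hw, smul_zero,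
      sub_zero]
  refine Set.mem_iUnion₂.2 ⟨k, hk.1, ?_⟩
  rw [← hsum, ← Finset.add_sum_erase _ _ hk.1, hνk, zero_smul, zero_add]
  exact Submodule.sum_mem _ fun i hi => Submodule.smul_mem _
    (⟨ν i, hν0 i (Finset.mem_of_mem_erase hi)⟩ : {r : ℝ // 0 ≤ r})
    (Submodule.subset_span ⟨i, hi, rfl⟩)

theorem isClosed_hull_image_of_linearIndepOn [NormedSpace ℝ E] {g : ι → E} {s : Finset ι}
    (hli : LinearIndepOn ℝ g (s : Set ι)) : IsClosed (PointedCone.hull ℝ (g '' s) : Set E) := by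
  have hemb := LinearMap.isClosedEmbedding_of_injective
    (LinearMap.ker_eq_bot.2 (LinearIndependent.fintypeLinearCombination_injective hli))
  convert hemb.isClosedMap _ (isClosed_Ici (a := (0 : s → ℝ))) using 1
  ext q
  rw [SetLike.mem_coe, PointedCone.hull, Submodule.mem_span_image_finset_iff_exists_fun]
  constructor
  · rintro ⟨c, rfl⟩
    exact ⟨fun i => c i, fun i => (c i).2, rfl⟩
  · rintro ⟨μ, hμ, rfl⟩
    exact ⟨fun i => ⟨μ i, hμ i⟩, rfl⟩

theorem isClosed_hull_image_finset [NormedSpace ℝ E] (g : ι → E) (s : Finset ι) :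
    IsClosed (PointedCone.hull ℝ (g '' s) : Set E) := by
  classical
  induction s using Finset.strongInduction with
  | H s ih =>
    by_cases hli : LinearIndepOn ℝ g (s : Set ι)
    · exact isClosed_hull_image_of_linearIndepOn hli
    · obtain ⟨w, hw, j, hj, hwj⟩ : ∃ w : ι → ℝ, ∑ i ∈ s, w i • g i = 0 ∧ ∃ j ∈ s, 0 < w j := by
        rw [linearIndepOn_finset_iff] at hli
        push Not at hli
        obtain ⟨w, hw, j, hj, hne⟩ := hli
        rcases hne.lt_or_gt with hneg | hpos
        · exact ⟨-w, by simp [hw], j, hj, neg_pos.2 hneg⟩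
        · exact ⟨w, hw, j, hj, hpos⟩
      rw [(hull_image_subset_iUnion_erase hw hj hwj).antisymm <| Set.iUnion₂_subset fun i _ =>
        Submodule.span_mono (Set.image_mono (Finset.coe_subset.2 (s.erase_subset i)))]
      exact s.finite_toSet.isClosed_biUnion fun i hi => ih _ (Finset.erase_ssubset hi)

theorem mem_hull_of_forall_inner_nonneg [InnerProductSpace ℝ E] [CompleteSpace E] {g : ι → E}
    {s : Finset ι} {q : E} (hq : ∀ w, (∀ i ∈ s, 0 ≤ inner ℝ (g i) w) → 0 ≤ inner ℝ q w) :
    q ∈ PointedCone.hull ℝ (g '' s) := by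
  by_contra hmem
  obtain ⟨w, hw, hneg⟩ := ProperCone.hyperplane_separation'
    ⟨PointedCone.hull ℝ (g '' s), isClosed_hull_image_finset g s⟩ hmem
  exact hneg.not_ge (hq w fun i hi => hw (g i) (Submodule.subset_span ⟨i, hi, rfl⟩))

end Cone

open scoped NNReal

section Halfspaces

variable {ι E : Type*} [NormedAddCommGroup E] [InnerProductSpace ℝ E] {g : ι → E} {h : ι → ℝ}
  {s : Finset ι}

/-- The polyhedron with normals `g i` and right-hand sides `h i`. -/
def halfspaces (g : ι → E) (h : ι → ℝ) : Set E :=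
  {u | ∀ i, inner ℝ (g i) u ≤ h i}

theorem isClosed_halfspaces (g : ι → E) (h : ι → ℝ) : IsClosed (halfspaces g h) := by
  simp only [halfspaces, Set.ofPred_forall]
  exact isClosed_iInter fun i => isClosed_le (by fun_prop) continuous_const

theorem lineMap_mem_halfspaces {h' : ι → ℝ} {u u' : E} (hu : u ∈ halfspaces g h)
    (hu' : u' ∈ halfspaces g h') {t : ℝ} (ht : t ∈ Set.Icc (0 : ℝ) 1) :
    AffineMap.lineMap u u' t ∈ halfspaces g (AffineMap.lineMap h h' t) := by
  intro i
  simp only [AffineMap.lineMap_apply_module, inner_add_right, inner_smul_right, Pi.add_apply,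
    Pi.smul_apply, smul_eq_mul]
  exact add_le_add (mul_le_mul_of_nonneg_left (hu i) (sub_nonneg.2 ht.2))
    (mul_le_mul_of_nonneg_left (hu' i) ht.1)

theorem convex_halfspaces (g : ι → E) (h : ι → ℝ) : Convex ℝ (halfspaces g h) :=
  convex_iff_segment_subset.2 fun u hu v hv => by
    rw [segment_eq_image_lineMap]
    rintro _ ⟨t, ht, rfl⟩
    simpa using lineMap_mem_halfspaces hu hv ht

theorem mem_normalCone_halfspaces_of_mem_hull {u q : E} (hu : u ∈ halfspaces g h)
    (hact : ∀ i ∈ s, inner ℝ (g i) u = h i) (hq : q ∈ PointedCone.hull ℝ (g '' s)) :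
    q ∈ normalCone (halfspaces g h) u := by
  obtain ⟨μ, hμ, rfl⟩ := mem_hull_image_finset_iff.1 hq
  refine ⟨hu, fun v hv => ?_⟩
  rw [sum_inner]
  refine Finset.sum_nonpos fun i hi => ?_
  rw [real_inner_smul_left, inner_sub_right, hact i hi]
  exact mul_nonpos_of_nonneg_of_nonpos (hμ i) (sub_nonpos.2 (hv i))

theorem eventually_sub_smul_mem_halfspaces [Finite ι] {u w : E} (hu : u ∈ halfspaces g h)
    (hw : ∀ i, inner ℝ (g i) u = h i → 0 ≤ inner ℝ (g i) w) :
    ∀ᶠ ε : ℝ in 𝓝[>] 0, u - ε • w ∈ halfspaces g h := by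
  refine eventually_all.2 fun i => ?_
  rcases (hu i).eq_or_lt with hi | hi
  · filter_upwards [self_mem_nhdsWithin] with ε hε
    rw [inner_sub_right, inner_smul_right, hi]
    linarith [mul_nonneg (le_of_lt hε) (hw i hi)]
  · have hlim : Tendsto (fun ε : ℝ => inner ℝ (g i) (u - ε • w)) (𝓝 0) (𝓝 (inner ℝ (g i) u)) :=
      (show Continuous _ by fun_prop).tendsto' _ _ (by simp)
    exact ((hlim.eventually_lt_const hi).filter_mono nhdsWithin_le_nhds).mono fun _ => le_of_lt

theorem mem_hull_of_mem_normalCone_halfspaces [Fintype ι] [CompleteSpace E] {u q : E}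
    (hq : q ∈ normalCone (halfspaces g h) u) :
    q ∈ PointedCone.hull ℝ (g '' ({i | inner ℝ (g i) u = h i} : Finset ι)) := by
  refine mem_hull_of_forall_inner_nonneg fun w hw => ?_
  obtain ⟨ε, hmem, hε⟩ := ((eventually_sub_smul_mem_halfspaces hq.1
    fun i hi => hw i (by simp [hi])).and self_mem_nhdsWithin).exists
  have := hq.2 _ hmem
  rw [sub_sub_cancel_left, inner_neg_right, inner_smul_right] at this
  exact nonneg_of_mul_nonneg_right (by linarith) hε

end Halfspaces

section FiniteClosedCover

variable {κ X Y : Type*} {C : ℝ≥0}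

theorem dist_le_of_finite_closed_cover [Finite κ] [PseudoMetricSpace X] {U : ℝ → X}
    {D : κ → Set ℝ} {a b : ℝ} (hab : a ≤ b) (hD : ∀ k, IsClosed (D k))
    (hcov : Set.Icc a b ⊆ ⋃ k, D k) (hU : ∀ k, LipschitzOnWith C U (D k)) :
    dist (U b) (U a) ≤ C * (b - a) := by
  have hcont : ContinuousOn U (Set.Icc a b) :=
    ((locallyFinite_of_finite D).continuousOn_iUnion hD fun k => (hU k).continuousOn).mono hcov
  have hclosed : IsClosed ({t | dist (U t) (U a) ≤ C * (t - a)} ∩ Set.Icc a b) := by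
    rw [Set.inter_comm]
    exact isClosed_Icc.isClosed_le (f := fun t => dist (U t) (U a)) (g := fun t => C * (t - a))
      (by fun_prop) (by fun_prop)
  refine hclosed.Icc_subset_of_forall_exists_gt (by simp) ?_ (Set.right_mem_Icc.2 hab)
  rintro t ⟨ht, hat, htb⟩ r (hr : t < r)
  have hpiece : ∀ᶠ s in 𝓝[>] t, ∀ k, s ∈ D k → t ∈ D k := by
    refine eventually_all.2 fun k => ?_
    by_cases hk : t ∈ D k
    · exact Eventually.of_forall fun _ _ => hk
    · exact (((hD k).isOpen_compl.eventually_mem hk).filter_mono nhdsWithin_le_nhds).mono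
        fun s hs hs' => absurd hs' hs
  obtain ⟨s, hs, hts, hsr⟩ := (hpiece.and (Ioc_mem_nhdsGT (lt_min hr htb))).exists
  obtain ⟨k, hk⟩ := Set.mem_iUnion.1 (hcov ⟨hat.trans hts.le, hsr.trans (min_le_right _ _)⟩)
  refine ⟨s, ?_, hts, hsr.trans (min_le_left _ _)⟩
  have hst := (hU k).dist_le_mul s hk t (hs k hk)
  rw [Real.dist_eq, abs_of_pos (sub_pos.2 hts)] at hst
  calc dist (U s) (U a) ≤ dist (U s) (U t) + dist (U t) (U a) := dist_triangle _ _ _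
    _ ≤ C * (s - t) + C * (t - a) := add_le_add hst ht
    _ = C * (s - a) := by ring

theorem isClosed_image_fst_of_dist_snd_le [MetricSpace X] [CompleteSpace X] [MetricSpace Y]
    [CompleteSpace Y] {Z : Set (X × Y)} (hZ : IsClosed Z)
    (hlip : ∀ a ∈ Z, ∀ b ∈ Z, dist a.2 b.2 ≤ C * dist a.1 b.1) : IsClosed (Prod.fst '' Z) := by
  have : CompleteSpace Z := hZ.completeSpace_coe
  have hanti : AntilipschitzWith (max 1 C) fun a : Z => (a : X × Y).1 := by
    refine AntilipschitzWith.of_le_mul_dist fun a b => max_le ?_ ((hlip a a.2 b b.2).trans ?_)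
    · exact le_mul_of_one_le_left dist_nonneg (le_max_left _ _)
    · exact mul_le_mul_of_nonneg_right (le_max_right _ _) dist_nonneg
  rw [Set.image_eq_range]
  exact hanti.isClosed_range (uniformContinuous_fst.comp uniformContinuous_subtype_val)

end FiniteClosedCover

section ActivePiece

variable {ι E : Type*} [NormedAddCommGroup E] [InnerProductSpace ℝ E] {g : ι → E}
  {s : Finset ι} {w : E}

/-- The pairs `(h, u)` such that `u` is the projection of `w` onto `halfspaces g h`, with
multipliers supported in `s` and all the inequalities of `s` active. -/
def activePiece (g : ι → E) (w : E) (s : Finset ι) : Set ((ι → ℝ) × E) :=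
  {q | q.2 ∈ halfspaces g q.1 ∧ (∀ i ∈ s, inner ℝ (g i) q.2 = q.1 i) ∧
    w - q.2 ∈ PointedCone.hull ℝ (g '' s)}

theorem sub_mem_normalCone_of_mem_activePiece {q : (ι → ℝ) × E} (hq : q ∈ activePiece g w s) :
    w - q.2 ∈ normalCone (halfspaces g q.1) q.2 :=
  mem_normalCone_halfspaces_of_mem_hull hq.1 hq.2.1 hq.2.2

theorem exists_mem_activePiece [Finite ι] [CompleteSpace E] {h : ι → ℝ} {u : E}
    (hu : w - u ∈ normalCone (halfspaces g h) u) : ∃ s, (h, u) ∈ activePiece g w s :=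
  have := Fintype.ofFinite ι
  ⟨_, hu.1, fun _ hi => (Finset.mem_filter.1 hi).2, mem_hull_of_mem_normalCone_halfspaces hu⟩

theorem isClosed_activePiece (g : ι → E) (w : E) (s : Finset ι) :
    IsClosed (activePiece g w s) := by
  have heq : activePiece g w s = (⋂ i, {q | inner ℝ (g i) q.2 ≤ q.1 i}) ∩
      ((⋂ i ∈ s, {q | inner ℝ (g i) q.2 = q.1 i}) ∩
        {q | w - q.2 ∈ PointedCone.hull ℝ (g '' s)}) := by
    ext
    simp [activePiece, halfspaces]
  rw [heq]
  exact (isClosed_iInter fun i => isClosed_le (by fun_prop) (by fun_prop)).inter <|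
    (isClosed_iInter fun i => isClosed_iInter fun _ =>
      isClosed_eq (by fun_prop) (by fun_prop)).inter <|
    (isClosed_hull_image_finset g s).preimage (by fun_prop)

theorem exists_norm_le_of_mem_span (g : ι → E) (s : Finset ι) :
    ∃ C : ℝ≥0, ∀ v ∈ Submodule.span ℝ (g '' s), ∀ r : ℝ, 0 ≤ r →
      (∀ i ∈ s, |inner ℝ (g i) v| ≤ r) → ‖v‖ ≤ C * r := by
  have : FiniteDimensional ℝ (Submodule.span ℝ (g '' s)) :=
    FiniteDimensional.span_of_finite ℝ (s.finite_toSet.image g)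
  let T : Submodule.span ℝ (g '' s) →ₗ[ℝ] (s → ℝ) :=
    LinearMap.pi fun i => (innerₛₗ ℝ (g i)).comp (Submodule.subtype _)
  have hT : LinearMap.ker T = ⊥ := by
    refine LinearMap.ker_eq_bot'.2 fun v hv => ?_
    have hperp : Submodule.span ℝ (g '' s) ≤ LinearMap.ker (innerₛₗ ℝ (v : E)) := by
      rw [Submodule.span_le]
      rintro _ ⟨i, hi, rfl⟩
      exact (real_inner_comm _ _).trans (congrFun hv ⟨i, hi⟩)
    exact Subtype.ext (inner_self_eq_zero.1 (hperp v.2))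
  obtain ⟨C, -, hC⟩ := T.exists_antilipschitzWith hT
  refine ⟨C, fun v hv r hr hvr => ?_⟩
  have hdist := hC.le_mul_dist (⟨v, hv⟩ : Submodule.span ℝ (g '' s)) 0
  rw [dist_zero_right, map_zero, dist_zero_right] at hdist
  exact hdist.trans (mul_le_mul_of_nonneg_left
    ((pi_norm_le_iff_of_nonneg hr).2 fun i => hvr i i.2) C.2)

theorem exists_dist_snd_le_of_mem_activePiece [Fintype ι] (g : ι → E) :
    ∃ C : ℝ≥0, ∀ (w : E) (s : Finset ι), ∀ a ∈ activePiece g w s, ∀ b ∈ activePiece g w s,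
      dist a.2 b.2 ≤ C * dist a.1 b.1 := by
  classical
  choose K hK using fun s : Finset ι => exists_norm_le_of_mem_span g s
  refine ⟨∑ s, K s, fun w s a ha b hb => ?_⟩
  have hspan : a.2 - b.2 ∈ Submodule.span ℝ (g '' s) := by
    have hle : (PointedCone.hull ℝ (g '' s) : Set E) ⊆ Submodule.span ℝ (g '' s) :=
      Submodule.span_subset_span _ _ _
    rw [← sub_sub_sub_cancel_left]
    exact sub_mem (hle hb.2.2) (hle ha.2.2)
  have hinner : ∀ i ∈ s, |inner ℝ (g i) (a.2 - b.2)| ≤ dist a.1 b.1 := fun i hi => by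
    rw [inner_sub_right, ha.2.1 i hi, hb.2.1 i hi, ← Real.dist_eq]
    exact dist_le_pi_dist _ _ i
  rw [dist_eq_norm]
  exact (hK s _ hspan _ dist_nonneg hinner).trans (mul_le_mul_of_nonneg_right
    (NNReal.coe_le_coe.2 (Finset.single_le_sum_of_canonicallyOrdered (Finset.mem_univ s)))
    dist_nonneg)

-- Along the segment from `h` to `h'` the active set of the projection changes finitely often,
-- and the projection is Lipschitz while it stays constant.
theorem exists_norm_sub_le_of_mem_normalCone_halfspaces [Fintype ι] [CompleteSpace E] (g : ι → E) :
    ∃ C : ℝ≥0, ∀ (h h' : ι → ℝ) (w u u' : E), w - u ∈ normalCone (halfspaces g h) u →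
      w - u' ∈ normalCone (halfspaces g h') u' → ‖u' - u‖ ≤ C * ‖h' - h‖ := by
  obtain ⟨C, hC⟩ := exists_dist_snd_le_of_mem_activePiece g
  refine ⟨C, fun h h' w u u' hu hu' => ?_⟩
  let path : ℝ → ι → ℝ := AffineMap.lineMap h h'
  have hproj : ∀ t ∈ Set.Icc (0 : ℝ) 1, ∃ a, w - a ∈ normalCone (halfspaces g (path t)) a :=
    fun t ht => exists_sub_mem_normalCone ⟨_, lineMap_mem_halfspaces hu.1 hu'.1 ht⟩
      (isClosed_halfspaces g _) (convex_halfspaces g _) w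
  choose! U hU using hproj
  have hdist (t₁ t₂ : ℝ) : dist (path t₁) (path t₂) = ‖h' - h‖ * dist t₁ t₂ := by
    rw [dist_lineMap_lineMap, dist_comm h, dist_eq_norm h', mul_comm]
  let D : Finset ι → Set ℝ := fun s => Set.Icc 0 1 ∩ path ⁻¹' (Prod.fst '' activePiece g w s)
  have hD : ∀ s, IsClosed (D s) := fun s => isClosed_Icc.inter <|
    (isClosed_image_fst_of_dist_snd_le (isClosed_activePiece g w s) (hC w s)).preimage
      AffineMap.lineMap_continuous
  have hcov : Set.Icc 0 1 ⊆ ⋃ s, D s := fun t ht => by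
    obtain ⟨s, hs⟩ := exists_mem_activePiece (hU t ht)
    exact Set.mem_iUnion.2 ⟨s, ht, _, hs, rfl⟩
  have hlip : ∀ s, LipschitzOnWith (C * ‖h' - h‖₊) U (D s) := fun s => by
    refine LipschitzOnWith.of_dist_le_mul ?_
    rintro t₁ ⟨ht₁, a, ha, ha₁⟩ t₂ ⟨ht₂, b, hb, hb₂⟩
    have hUa := eq_of_sub_mem_normalCone
      (ha₁ ▸ sub_mem_normalCone_of_mem_activePiece ha) (hU t₁ ht₁)
    have hUb := eq_of_sub_mem_normalCone
      (hb₂ ▸ sub_mem_normalCone_of_mem_activePiece hb) (hU t₂ ht₂)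
    have hab := hC w s a ha b hb
    rwa [hUa, hUb, ha₁, hb₂, hdist, ← mul_assoc] at hab
  have hend := dist_le_of_finite_closed_cover zero_le_one hD hcov hlip
  have hU0 : U 0 = u := eq_of_sub_mem_normalCone (hU 0 (by simp)) (by simpa [path] using hu)
  have hU1 : U 1 = u' := eq_of_sub_mem_normalCone (hU 1 (by simp)) (by simpa [path] using hu')
  rwa [hU0, hU1, dist_eq_norm, sub_zero, mul_one] at hend

end ActivePiece

section SingularValues

variable {𝕜 E F : Type*} [RCLike 𝕜] [NormedAddCommGroup E] [InnerProductSpace 𝕜 E]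
  [FiniteDimensional 𝕜 E] [NormedAddCommGroup F] [InnerProductSpace 𝕜 F] [FiniteDimensional 𝕜 F]

theorem re_inner_adjoint_comp_self_le (T : E →ₗ[𝕜] F) (x : E) :
    RCLike.re (inner 𝕜 x ((LinearMap.adjoint T ∘ₗ T) x)) ≤ T.singularValues 0 ^ 2 * ‖x‖ ^ 2 := by
  have hT := T.isSymmetric_adjoint_comp_self
  set e := hT.eigenvectorBasis rfl with he
  rw [← e.repr.inner_map_map, ← e.repr.norm_map, EuclideanSpace.norm_sq_eq, Finset.mul_sum,
    PiLp.inner_apply, map_sum]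
  refine Finset.sum_le_sum fun i _ => ?_
  rw [he, hT.eigenvectorBasis_apply_self_apply, RCLike.inner_apply, mul_assoc, RCLike.mul_conj,
    ← RCLike.ofReal_pow, ← RCLike.ofReal_mul, RCLike.ofReal_re,
    T.sq_singularValues_of_lt rfl i.pos]
  exact mul_le_mul_of_nonneg_right
    (hT.eigenvalues_antitone rfl (Fin.mk_le_of_le_val (Nat.zero_le _))) (sq_nonneg _)

theorem norm_apply_le_singularValues_zero_mul (T : E →ₗ[𝕜] F) (x : E) :
    ‖T x‖ ≤ T.singularValues 0 * ‖x‖ := by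
  refine le_of_sq_le_sq ?_ (mul_nonneg (T.singularValues_nonneg 0) (norm_nonneg x))
  calc ‖T x‖ ^ 2 = RCLike.re (inner 𝕜 x ((LinearMap.adjoint T ∘ₗ T) x)) := by
        rw [LinearMap.comp_apply, LinearMap.adjoint_inner_right, inner_self_eq_norm_sq]
    _ ≤ T.singularValues 0 ^ 2 * ‖x‖ ^ 2 := re_inner_adjoint_comp_self_le T x
    _ = (T.singularValues 0 * ‖x‖) ^ 2 := (mul_pow _ _ 2).symm

end SingularValues

section Matrix

variable {n m l : ℕ} (A : Matrix (Fin m) (Fin n) ℝ) (G : Matrix (Fin l) (Fin n) ℝ)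

theorem inner_mulV (x : Vec n) (y : Vec m) :
    inner ℝ (mulV A x) y = inner ℝ x (mulV A.transpose y) := by
  have hadj := Matrix.toEuclideanLin_conjTranspose_eq_adjoint A
  rw [Matrix.conjTranspose_eq_transpose_of_trivial] at hadj
  rw [mulV, mulV, hadj, LinearMap.adjoint_inner_right]

theorem mulV_sub (x x' : Vec n) : mulV A (x - x') = mulV A x - mulV A x' :=
  map_sub _ x x'

theorem continuous_mulV : Continuous (mulV A) :=
  LinearMap.continuous_of_finiteDimensional _

theorem sigmaMax_nonneg : 0 ≤ sigmaMax A :=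
  LinearMap.singularValues_nonneg _ _

theorem norm_mulV_le (x : Vec n) : ‖mulV A x‖ ≤ sigmaMax A * ‖x‖ :=
  norm_apply_le_singularValues_zero_mul _ x

theorem norm_sq_mulV_le (x : Vec n) : ‖mulV A x‖ ^ 2 ≤ sigmaMax A ^ 2 * ‖x‖ ^ 2 := by
  rw [← mul_pow]
  exact pow_le_pow_left₀ (norm_nonneg _) (norm_mulV_le A x) 2

theorem norm_mulV_transpose_le (y : Vec m) : ‖mulV A.transpose y‖ ≤ sigmaMax A * ‖y‖ := by
  rcases (norm_nonneg (mulV A.transpose y)).eq_or_lt with h0 | h0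
  · rw [← h0]
    exact mul_nonneg (sigmaMax_nonneg A) (norm_nonneg y)
  · refine le_of_mul_le_mul_right ?_ h0
    calc ‖mulV A.transpose y‖ * ‖mulV A.transpose y‖
        = inner ℝ (mulV A (mulV A.transpose y)) y := by
          rw [inner_mulV, real_inner_self_eq_norm_mul_norm]
      _ ≤ ‖mulV A (mulV A.transpose y)‖ * ‖y‖ := real_inner_le_norm _ _
      _ ≤ sigmaMax A * ‖mulV A.transpose y‖ * ‖y‖ :=
          mul_le_mul_of_nonneg_right (norm_mulV_le A _) (norm_nonneg y)
      _ = sigmaMax A * ‖y‖ * ‖mulV A.transpose y‖ := mul_right_comm _ _ _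

/-- The rows of a matrix as Euclidean vectors, the normals of the polyhedron `G x ≤ h`. -/
def rowV (i : Fin m) : Vec n :=
  WithLp.toLp 2 (A i)

theorem inner_rowV (i : Fin m) (x : Vec n) : inner ℝ (rowV A i) x = mulV A x i := by
  simp [rowV, Matrix.toLpLin_apply, Matrix.mulVec, dotProduct, PiLp.inner_apply, mul_comm]

theorem mulV_transpose_eq_sum (μ : Vec m) : mulV A.transpose μ = ∑ i, μ i • rowV A i := by
  ext j
  simp [rowV, Matrix.toLpLin_apply, Matrix.mulVec, dotProduct, mul_comm]

end Matrix

section FeasibleSet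

variable {n m l : ℕ} (A : Matrix (Fin m) (Fin n) ℝ) (b : Vec m) (G : Matrix (Fin l) (Fin n) ℝ)
  (h : Vec l)

theorem polyhedron_eq_halfspaces : polyhedron G h = halfspaces (rowV G) h := by
  ext x
  simp only [polyhedron, halfspaces, inner_rowV]

theorem isClosed_polyhedron : IsClosed (polyhedron G h) := by
  rw [polyhedron_eq_halfspaces]
  exact isClosed_halfspaces _ _

theorem convex_polyhedron : Convex ℝ (polyhedron G h) := by
  rw [polyhedron_eq_halfspaces]
  exact convex_halfspaces _ _

theorem feasibleSet_subset_polyhedron : feasibleSet A b G h ⊆ polyhedron G h :=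
  fun _ hx => hx.1

theorem isClosed_feasibleSet : IsClosed (feasibleSet A b G h) :=
  (isClosed_polyhedron G h).inter (isClosed_eq (continuous_mulV A) continuous_const)

theorem convex_feasibleSet : Convex ℝ (feasibleSet A b G h) :=
  (convex_polyhedron G h).inter ((convex_singleton b).linear_preimage (Matrix.toEuclideanLin A))

theorem feasibleSet_eq_halfspaces : feasibleSet A b G h =
    halfspaces (Sum.elim (rowV G) (Sum.elim (rowV A) fun i => -rowV A i))
      (Sum.elim h (Sum.elim b fun i => -b i)) := by
  ext v
  simp only [halfspaces, feasibleSet, polyhedron, Set.mem_ofPred_eq, Sum.forall, Sum.elim_inl,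
    Sum.elim_inr, inner_rowV, inner_neg_left, neg_le_neg_iff]
  refine and_congr_right fun _ => ⟨fun hv => by simp [hv], fun hv => ?_⟩
  ext i
  exact le_antisymm (hv.1 i) (hv.2 i)

/-- `C` bounds how fast the projection onto the slice `{x | G x ≤ h, A x = d}` moves with `d`,
uniformly in `h` and in the projected point. -/
def IsSliceLipschitz (C : ℝ) : Prop :=
  ∀ (h : Vec l) (d d' : Vec m) (w u u' : Vec n), w - u ∈ normalCone (feasibleSet A d G h) u →
    w - u' ∈ normalCone (feasibleSet A d' G h) u' → ‖u' - u‖ ≤ C * ‖d' - d‖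

theorem exists_isSliceLipschitz : ∃ C : ℝ, IsSliceLipschitz A G C := by
  obtain ⟨C, hC⟩ := exists_norm_sub_le_of_mem_normalCone_halfspaces
    (Sum.elim (rowV G) (Sum.elim (rowV A) fun i => -rowV A i))
  refine ⟨C, fun h d d' w u u' hu hu' => ?_⟩
  rw [feasibleSet_eq_halfspaces] at hu hu'
  refine (hC _ _ w u u' hu hu').trans (mul_le_mul_of_nonneg_left ?_ C.2)
  have hcoord (i : Fin m) : |d' i - d i| ≤ ‖d' - d‖ := PiLp.norm_apply_le (d' - d) i
  refine (pi_norm_le_iff_of_nonneg (norm_nonneg _)).2 ?_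
  rintro (i | i | i)
  · simp
  · simpa using hcoord i
  · simpa [neg_add_eq_sub, abs_sub_comm] using hcoord i

end FeasibleSet

section Smooth

variable {E : Type*} [NormedAddCommGroup E] [InnerProductSpace ℝ E] {S : Set E}

/-- `f` is `L`-smooth on `S`: its gradient, taken in the whole space, exists at the points of `S`
and is `L`-Lipschitz there. -/
structure LSmoothOn [CompleteSpace E] (f : E → ℝ) (S : Set E) (L : ℝ) : Prop where
  differentiableAt : ∀ u ∈ S, DifferentiableAt ℝ f u
  norm_gradient_sub_le : ∀ u ∈ S, ∀ u' ∈ S, ‖gradient f u - gradient f u'‖ ≤ L * ‖u - u'‖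

theorem LSmoothOn.abs_sub_sub_inner_gradient_le [CompleteSpace E] {f : E → ℝ} {L : ℝ}
    (hf : LSmoothOn f S L) (hS : Convex ℝ S) {u v : E} (hu : u ∈ S) (hv : v ∈ S) :
    |f v - f u - inner ℝ (gradient f u) (v - u)| ≤ L / 2 * ‖v - u‖ ^ 2 := by
  set d := v - u with hd
  let ψ : ℝ → ℝ := fun t => f (u + t • d) - f u - t * inner ℝ (gradient f u) d
  let ψ' : ℝ → ℝ := fun t => inner ℝ (gradient f (u + t • d) - gradient f u) d
  have hmem : ∀ t ∈ Set.Icc (0 : ℝ) 1, u + t • d ∈ S := fun t ht => hS.add_smul_sub_mem hu hv ht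
  have hψ : ∀ t ∈ Set.Icc (0 : ℝ) 1, HasDerivAt ψ (ψ' t) t := by
    intro t ht
    have hline : HasDerivAt (fun t : ℝ => u + t • d) d t := by
      simpa using ((hasDerivAt_id t).smul_const d).const_add u
    have hcomp := (hf.differentiableAt _ (hmem t ht)).hasGradientAt.hasFDerivAt.comp_hasDerivAt
      t hline
    refine ((hcomp.sub_const (f u)).sub
      ((hasDerivAt_id t).mul_const (inner ℝ (gradient f u) d))).congr_deriv ?_
    simp [ψ', inner_sub_left]
  have hψ' : ∀ t ∈ Set.Ico (0 : ℝ) 1, ‖ψ' t‖ ≤ L * ‖d‖ ^ 2 * t := fun t ht => by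
    calc ‖ψ' t‖ ≤ ‖gradient f (u + t • d) - gradient f u‖ * ‖d‖ := norm_inner_le_norm _ _
      _ ≤ (L * ‖u + t • d - u‖) * ‖d‖ := mul_le_mul_of_nonneg_right
          (hf.norm_gradient_sub_le _ (hmem t (Set.Ico_subset_Icc_self ht)) _ hu) (norm_nonneg d)
      _ = L * ‖d‖ ^ 2 * t := by
          rw [add_sub_cancel_left, norm_smul, Real.norm_of_nonneg ht.1]
          ring
  have hB (t : ℝ) : HasDerivAt (fun t => L / 2 * ‖d‖ ^ 2 * t ^ 2) (L * ‖d‖ ^ 2 * t) t :=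
    ((hasDerivAt_pow 2 t).const_mul (L / 2 * ‖d‖ ^ 2)).congr_deriv (by norm_num; ring)
  have hbound := image_norm_le_of_norm_deriv_right_le_deriv_boundary
    (fun t ht => (hψ t ht).continuousAt.continuousWithinAt)
    (fun t ht => (hψ t (Set.Ico_subset_Icc_self ht)).hasDerivWithinAt) (by simp [ψ]) hB hψ'
    (Set.right_mem_Icc.2 zero_le_one)
  simpa [ψ, hd] using hbound

theorem exists_isMinOn_of_quadratic_growth [ProperSpace E] {F : E → ℝ} {q u₀ : E} {γ : ℝ}
    (hF : ContinuousOn F S) (hS : IsClosed S) (hu₀ : u₀ ∈ S) (hγ : 0 < γ)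
    (hgrow : ∀ v ∈ S, F u₀ + inner ℝ q (v - u₀) + γ / 2 * ‖v - u₀‖ ^ 2 ≤ F v) :
    ∃ x ∈ S, IsMinOn F S x := by
  refine hF.exists_isMinOn' hS hu₀ ?_
  have hfar : ∀ᶠ v in cocompact E, 2 * ‖q‖ / γ ≤ ‖v - u₀‖ :=
    ((tendsto_norm_cocompact_atTop (E := E)).comp
      (Homeomorph.subRight u₀).isClosedEmbedding.tendsto_cocompact).eventually_ge_atTop _
  filter_upwards [hfar.filter_mono inf_le_left, mem_inf_of_right (mem_principal_self S)]
    with v hv hvS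
  have hinner : -(‖q‖ * ‖v - u₀‖) ≤ inner ℝ q (v - u₀) :=
    (abs_le.1 (abs_real_inner_le_norm q (v - u₀))).1
  have := mul_le_mul_of_nonneg_right ((div_le_iff₀ hγ).1 hv) (norm_nonneg (v - u₀))
  linarith [hgrow v hvS]

theorem mul_norm_sub_le_of_gradient_step {g : E → E} {x x' X : E} {c L μ : ℝ} (hc : 0 ≤ c)
    (hstep : x - c • g x - x' ∈ normalCone S x') (hX : -g X ∈ normalCone S X)
    (hlip : ‖g x - g x'‖ ≤ L * ‖x - x'‖)
    (hmono : μ * ‖x' - X‖ ^ 2 ≤ inner ℝ (g x' - g X) (x' - X)) :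
    c * μ * ‖x' - X‖ ≤ (1 + c * L) * ‖x - x'‖ := by
  have herr : c * μ * ‖x' - X‖ ≤ ‖x - x' - c • (g x - g x')‖ := by
    refine mul_norm_sub_le_of_mem_normalCone (S := S) (q := c • g x') (q' := c • g X) ?_ ?_ ?_
    · convert hstep using 1
      rw [smul_sub]
      abel
    · simpa using smul_mem_normalCone hc hX
    · rw [← smul_sub, real_inner_smul_left, mul_assoc]
      exact mul_le_mul_of_nonneg_left hmono hc
  calc c * μ * ‖x' - X‖ ≤ ‖x - x'‖ + c * ‖g x - g x'‖ := by
        refine herr.trans ((norm_sub_le _ _).trans_eq ?_)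
        rw [norm_smul, Real.norm_of_nonneg hc]
    _ ≤ ‖x - x'‖ + c * (L * ‖x - x'‖) := by gcongr
    _ = (1 + c * L) * ‖x - x'‖ := by ring

theorem le_sub_of_gradient_step {F : E → ℝ} {x x' q : E} {c L : ℝ} (hc : 0 < c) (hcL : L ≤ 1 / c)
    (hx : x ∈ S) (hstep : x - c • q - x' ∈ normalCone S x')
    (hF : F x' ≤ F x + inner ℝ q (x' - x) + L / 2 * ‖x' - x‖ ^ 2) :
    F x' ≤ F x - 1 / (2 * c) * ‖x - x'‖ ^ 2 := by
  have hvi : 1 / c * ‖x - x'‖ ^ 2 ≤ inner ℝ q (x - x') := by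
    have h := hstep.2 x hx
    rw [sub_right_comm, inner_sub_left, real_inner_smul_left, real_inner_self_eq_norm_sq] at h
    rw [one_div, inv_mul_le_iff₀ hc]
    linarith
  rw [← neg_sub x x', inner_neg_right, norm_neg] at hF
  have hquad := mul_le_mul_of_nonneg_right hcL (sq_nonneg ‖x - x'‖)
  have hhalf : 1 / (2 * c) * ‖x - x'‖ ^ 2 = 1 / c * ‖x - x'‖ ^ 2 / 2 := by field_simp
  linarith

end Smooth

section ProxLag

variable {n m l : ℕ}

section Expansion

variable (f : Vec n → ℝ) (A : Matrix (Fin m) (Fin n) ℝ) (b : Vec m) (ρ p : ℝ) (x z : Vec n)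
  (y : Vec m)

/-- The gradient of the proximal augmented Lagrangian `K(x, z; y)` in `x`. -/
noncomputable def gradProxLag : Vec n :=
  gradient f x + mulV A.transpose (y + ρ • (mulV A x - b)) + p • (x - z)

theorem proxLag_eq_add_remainder (v : Vec n) :
    proxLag f A b ρ p v z y = proxLag f A b ρ p x z y
      + inner ℝ (gradProxLag f A b ρ p x z y) (v - x)
      + (f v - f x - inner ℝ (gradient f x) (v - x))
      + ρ / 2 * ‖mulV A (v - x)‖ ^ 2 + p / 2 * ‖v - x‖ ^ 2 := by
  have hA : mulV A v - b = (mulV A x - b) + mulV A (v - x) := by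
    rw [mulV_sub]
    abel
  have hz : v - z = (x - z) + (v - x) := by abel
  rw [proxLag, augLag, hA, hz, norm_add_sq_real, norm_add_sq_real, proxLag, augLag, gradProxLag,
    inner_add_left, inner_add_left, real_inner_comm (v - x) (mulV A.transpose _), ← inner_mulV,
    inner_add_right, inner_add_right, real_inner_smul_right, real_inner_smul_left,
    real_inner_comm y, real_inner_comm (mulV A x - b) (mulV A (v - x))]
  ring

theorem proxLag_add_dual (w : Vec m) :
    proxLag f A b ρ p x z (y + w) = proxLag f A b ρ p x z y + inner ℝ w (mulV A x - b) := by
  rw [proxLag, augLag, inner_add_left, proxLag, augLag]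
  ring

theorem proxLag_add_center (β : ℝ) (d : Vec n) :
    proxLag f A b ρ p x (z + β • d) y = proxLag f A b ρ p x z y
      + p / 2 * (β ^ 2 * ‖d‖ ^ 2 - 2 * β * inner ℝ d (x - z)) := by
  rw [proxLag, ← sub_sub, norm_sub_sq_real, real_inner_smul_right, norm_smul, mul_pow,
    Real.norm_eq_abs, sq_abs, real_inner_comm, proxLag]
  ring

variable {A b x} in
theorem proxLag_eq_of_mulV_eq (hx : mulV A x = b) :
    proxLag f A b ρ p x z y = f x + p / 2 * ‖x - z‖ ^ 2 := by
  simp [proxLag, augLag, hx]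

variable {f x} in
theorem hasGradientAt_proxLag (hf : DifferentiableAt ℝ f x) :
    HasGradientAt (fun u => proxLag f A b ρ p u z y) (gradProxLag f A b ρ p x z y) x := by
  have hquad : (fun v => ‖v - x‖ ^ 2) =o[𝓝 x] fun v => v - x :=
    Asymptotics.isLittleO_pow_sub_sub x one_lt_two
  have hquadA : (fun v => ‖mulV A (v - x)‖ ^ 2) =o[𝓝 x] fun v => v - x :=
    (Asymptotics.IsBigO.of_bound (sigmaMax A ^ 2) (Eventually.of_forall fun v => by
      simpa using norm_sq_mulV_le A (v - x))).trans_isLittleO hquad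
  rw [hasGradientAt_iff_isLittleO]
  refine ((hasGradientAt_iff_isLittleO.1 hf.hasGradientAt).add
    ((hquadA.const_mul_left (ρ / 2)).add (hquad.const_mul_left (p / 2)))).congr_left fun v => ?_
  rw [proxLag_eq_add_remainder f A b ρ p x z y v]
  ring

end Expansion

variable {f : Vec n → ℝ} {A : Matrix (Fin m) (Fin n) ℝ} {b : Vec m} {G : Matrix (Fin l) (Fin n) ℝ}
  {h : Vec l} {Lf ρ p : ℝ} {x v z : Vec n} {y : Vec m}

theorem proxLag_lower_bound (hf : LSmoothOn f (polyhedron G h) Lf) (hρ : 0 ≤ ρ)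
    (hx : x ∈ polyhedron G h) (hv : v ∈ polyhedron G h) :
    proxLag f A b ρ p x z y + inner ℝ (gradProxLag f A b ρ p x z y) (v - x)
      + (p - Lf) / 2 * ‖v - x‖ ^ 2 ≤ proxLag f A b ρ p v z y := by
  have hrem := (abs_le.1 (hf.abs_sub_sub_inner_gradient_le (convex_polyhedron G h) hx hv)).1
  have hA : 0 ≤ ρ / 2 * ‖mulV A (v - x)‖ ^ 2 := by positivity
  linarith [proxLag_eq_add_remainder f A b ρ p x z y v]

theorem proxLag_upper_bound (hf : LSmoothOn f (polyhedron G h) Lf) (hρ : 0 ≤ ρ)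
    (hx : x ∈ polyhedron G h) (hv : v ∈ polyhedron G h) :
    proxLag f A b ρ p v z y ≤ proxLag f A b ρ p x z y
      + inner ℝ (gradProxLag f A b ρ p x z y) (v - x)
      + (Lf + ρ * sigmaMax A ^ 2 + p) / 2 * ‖v - x‖ ^ 2 := by
  have hrem := (abs_le.1 (hf.abs_sub_sub_inner_gradient_le (convex_polyhedron G h) hx hv)).2
  have hA := mul_le_mul_of_nonneg_left (norm_sq_mulV_le A (v - x)) (div_nonneg hρ zero_le_two)
  linarith [proxLag_eq_add_remainder f A b ρ p x z y v]

theorem gradProxLag_strongly_monotone (hf : LSmoothOn f (polyhedron G h) Lf) (hρ : 0 ≤ ρ)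
    (hx : x ∈ polyhedron G h) (hv : v ∈ polyhedron G h) :
    (p - Lf) * ‖x - v‖ ^ 2 ≤
      inner ℝ (gradProxLag f A b ρ p x z y - gradProxLag f A b ρ p v z y) (x - v) := by
  have hxv := proxLag_lower_bound (A := A) (b := b) (p := p) (z := z) (y := y) hf hρ hx hv
  have hvx := proxLag_lower_bound (A := A) (b := b) (p := p) (z := z) (y := y) hf hρ hv hx
  rw [← neg_sub x v, inner_neg_right, norm_neg] at hxv
  rw [inner_sub_left]
  linarith

theorem norm_gradProxLag_sub_le (hf : LSmoothOn f (polyhedron G h) Lf) (hρ : 0 ≤ ρ) (hp : 0 ≤ p)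
    (hx : x ∈ polyhedron G h) (hv : v ∈ polyhedron G h) :
    ‖gradProxLag f A b ρ p x z y - gradProxLag f A b ρ p v z y‖
      ≤ (Lf + ρ * sigmaMax A ^ 2 + p) * ‖x - v‖ := by
  have hAA : ‖mulV A.transpose (mulV A (x - v))‖ ≤ sigmaMax A * (sigmaMax A * ‖x - v‖) :=
    (norm_mulV_transpose_le A _).trans
      (mul_le_mul_of_nonneg_left (norm_mulV_le A _) (sigmaMax_nonneg A))
  calc ‖gradProxLag f A b ρ p x z y - gradProxLag f A b ρ p v z y‖
      = ‖(gradient f x - gradient f v) + ρ • mulV A.transpose (mulV A (x - v)) + p • (x - v)‖ := by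
        congr 1
        simp only [gradProxLag, map_add, map_smul, map_sub, smul_sub]
        abel
    _ ≤ ‖gradient f x - gradient f v‖ + ρ * ‖mulV A.transpose (mulV A (x - v))‖
          + p * ‖x - v‖ := by
        refine norm_add₃_le.trans_eq ?_
        rw [norm_smul, norm_smul, Real.norm_of_nonneg hρ, Real.norm_of_nonneg hp]
    _ ≤ Lf * ‖x - v‖ + ρ * (sigmaMax A * (sigmaMax A * ‖x - v‖)) + p * ‖x - v‖ := by
        gcongr
        exact hf.norm_gradient_sub_le x hx v hv
    _ = (Lf + ρ * sigmaMax A ^ 2 + p) * ‖x - v‖ := by ring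

end ProxLag

section Minimizers

variable {n m l : ℕ} {f : Vec n → ℝ} {A : Matrix (Fin m) (Fin n) ℝ} {b : Vec m}
  {G : Matrix (Fin l) (Fin n) ℝ} {h : Vec l} {Lf ρ p : ℝ} {S : Set (Vec n)} {X z : Vec n}
  {y : Vec m}

theorem exists_neg_gradProxLag_mem_normalCone (hf : LSmoothOn f (polyhedron G h) Lf) (hρ : 0 ≤ ρ)
    (hp : Lf < p) (hSP : S ⊆ polyhedron G h) (hcl : IsClosed S) (hcv : Convex ℝ S)
    (hne : S.Nonempty) (z : Vec n) (y : Vec m) :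
    ∃ X, -gradProxLag f A b ρ p X z y ∈ normalCone S X := by
  obtain ⟨u₀, hu₀⟩ := hne
  have hgrad (u : Vec n) (hu : u ∈ S) :=
    hasGradientAt_proxLag A b ρ p z y (hf.differentiableAt u (hSP hu))
  obtain ⟨X, hX, hmin⟩ := exists_isMinOn_of_quadratic_growth
    (fun u hu => (hgrad u hu).continuousAt.continuousWithinAt) hcl hu₀ (sub_pos.2 hp)
    fun v hv => proxLag_lower_bound hf hρ (hSP hu₀) (hSP hv)
  exact ⟨X, neg_mem_normalCone_of_isMinOn hcv hX (hgrad X hX) hmin⟩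

theorem isMinOn_proxLag (hf : LSmoothOn f (polyhedron G h) Lf) (hρ : 0 ≤ ρ) (hp : Lf ≤ p)
    (hSP : S ⊆ polyhedron G h) (hX : -gradProxLag f A b ρ p X z y ∈ normalCone S X) :
    IsMinOn (fun u => proxLag f A b ρ p u z y) S X := by
  refine isMinOn_iff.2 fun u hu => ?_
  have hinner := hX.2 u hu
  rw [inner_neg_left] at hinner
  have hquad : 0 ≤ (p - Lf) / 2 * ‖u - X‖ ^ 2 :=
    mul_nonneg (div_nonneg (sub_nonneg.2 hp) zero_le_two) (sq_nonneg _)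
  linarith [proxLag_lower_bound (A := A) (b := b) (p := p) (z := z) (y := y) hf hρ (hSP hX.1)
    (hSP hu)]

theorem sInf_image_proxLag_eq (hf : LSmoothOn f (polyhedron G h) Lf) (hρ : 0 ≤ ρ) (hp : Lf ≤ p)
    (hSP : S ⊆ polyhedron G h) (hX : -gradProxLag f A b ρ p X z y ∈ normalCone S X) :
    sInf ((fun u => proxLag f A b ρ p u z y) '' S) = proxLag f A b ρ p X z y :=
  IsLeast.csInf_eq ⟨Set.mem_image_of_mem _ hX.1,
    Set.forall_mem_image.2 (isMinOn_iff.1 (isMinOn_proxLag hf hρ hp hSP hX))⟩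

theorem sInf_image_proxLag_le (hf : LSmoothOn f (polyhedron G h) Lf) (hρ : 0 ≤ ρ) (hp : Lf < p)
    (hSP : S ⊆ polyhedron G h) (hcl : IsClosed S) (hcv : Convex ℝ S) {u : Vec n} (hu : u ∈ S) :
    sInf ((fun u => proxLag f A b ρ p u z y) '' S) ≤ proxLag f A b ρ p u z y := by
  obtain ⟨X, hX⟩ := exists_neg_gradProxLag_mem_normalCone (A := A) (b := b) hf hρ hp hSP hcl hcv
    ⟨u, hu⟩ z y
  exact (sInf_image_proxLag_eq hf hρ hp.le hSP hX).trans_le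
    (isMinOn_proxLag hf hρ hp.le hSP hX hu)

theorem dualFn_eq (hf : LSmoothOn f (polyhedron G h) Lf) (hρ : 0 ≤ ρ) (hp : Lf ≤ p)
    (hX : -gradProxLag f A b ρ p X z y ∈ normalCone (polyhedron G h) X) :
    dualFn f A b G h ρ p y z = proxLag f A b ρ p X z y :=
  sInf_image_proxLag_eq hf hρ hp subset_rfl hX

theorem dualFn_le (hf : LSmoothOn f (polyhedron G h) Lf) (hρ : 0 ≤ ρ) (hp : Lf < p) {u : Vec n}
    (hu : u ∈ polyhedron G h) : dualFn f A b G h ρ p y z ≤ proxLag f A b ρ p u z y :=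
  sInf_image_proxLag_le hf hρ hp subset_rfl (isClosed_polyhedron G h) (convex_polyhedron G h) hu

theorem proxFn_eq_sInf_image_proxLag (ρ : ℝ) (y : Vec m) :
    proxFn f A b G h p z = sInf ((fun u => proxLag f A b ρ p u z y) '' feasibleSet A b G h) :=
  congrArg sInf (Set.image_congr fun _ hu => (proxLag_eq_of_mulV_eq f ρ p z y hu.2).symm)

theorem proxFn_eq (hf : LSmoothOn f (polyhedron G h) Lf) (hρ : 0 ≤ ρ) (hp : Lf ≤ p)
    (hX : -gradProxLag f A b ρ p X z y ∈ normalCone (feasibleSet A b G h) X) :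
    proxFn f A b G h p z = proxLag f A b ρ p X z y :=
  (proxFn_eq_sInf_image_proxLag ρ y).trans
    (sInf_image_proxLag_eq hf hρ hp (feasibleSet_subset_polyhedron A b G h) hX)

theorem proxFn_le (hf : LSmoothOn f (polyhedron G h) Lf) (hρ : 0 ≤ ρ) (hp : Lf < p) {u : Vec n}
    (hu : u ∈ feasibleSet A b G h) : proxFn f A b G h p z ≤ proxLag f A b ρ p u z y :=
  (proxFn_eq_sInf_image_proxLag ρ y).trans_le
    (sInf_image_proxLag_le hf hρ hp (feasibleSet_subset_polyhedron A b G h)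
      (isClosed_feasibleSet A b G h) (convex_feasibleSet A b G h) hu)

end Minimizers

section ErrorBounds

variable {n m l : ℕ} {f : Vec n → ℝ} {A : Matrix (Fin m) (Fin n) ℝ} {b : Vec m}
  {G : Matrix (Fin l) (Fin n) ℝ} {h : Vec l} {Lf ρ p c : ℝ}

/-- The constant of the primal error bound `‖x' - X‖ ≤ σ ‖x - x'‖`, where `x'` is the projected
gradient step of length `c` from `x`, and `X` minimizes `K(·, z; y)` over `P`. -/
noncomputable def primalErrorConst (A : Matrix (Fin m) (Fin n) ℝ) (Lf ρ p c : ℝ) : ℝ :=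
  (1 + c * (Lf + ρ * sigmaMax A ^ 2 + p)) / (c * (p - Lf))

/-- The Lipschitz constant, in the prox center `z`, of the minimizer of `K(·, z; y)` over `P`. -/
noncomputable def centerErrorConst (Lf p : ℝ) : ℝ :=
  p / (p - Lf)

/-- The constant of the dual error bound `‖X - Y‖ ≤ τ ‖A X - b‖` between the minimizers `X` and `Y`
of `K(·, z; y)` over `P` and over the feasible set, where `C` is a Lipschitz constant of the
projections onto the slices `{x ∈ P | A x = d}`. -/
noncomputable def dualErrorConst (Lf p C : ℝ) : ℝ :=
  p * C / (p - Lf)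

theorem norm_sub_le_primalErrorConst_mul (hf : LSmoothOn f (polyhedron G h) Lf) (hρ : 0 ≤ ρ)
    (hp : 0 ≤ p) (hpLf : Lf < p) (hc : 0 < c) {x x' X z : Vec n} {y : Vec m}
    (hx : x ∈ polyhedron G h)
    (hstep : x - c • gradProxLag f A b ρ p x z y - x' ∈ normalCone (polyhedron G h) x')
    (hX : -gradProxLag f A b ρ p X z y ∈ normalCone (polyhedron G h) X) :
    ‖x' - X‖ ≤ primalErrorConst A Lf ρ p c * ‖x - x'‖ := by
  have h := mul_norm_sub_le_of_gradient_step (g := fun u => gradProxLag f A b ρ p u z y) hc.le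
    hstep hX (norm_gradProxLag_sub_le hf hρ hp hx hstep.1)
    (gradProxLag_strongly_monotone hf hρ hstep.1 hX.1)
  rwa [primalErrorConst, div_mul_eq_mul_div, le_div_iff₀' (mul_pos hc (sub_pos.2 hpLf))]

theorem norm_sub_le_centerErrorConst_mul (hf : LSmoothOn f (polyhedron G h) Lf) (hρ : 0 ≤ ρ)
    (hp : 0 ≤ p) (hpLf : Lf < p) {X X' z z' : Vec n} {y : Vec m}
    (hX : -gradProxLag f A b ρ p X z y ∈ normalCone (polyhedron G h) X)
    (hX' : -gradProxLag f A b ρ p X' z' y ∈ normalCone (polyhedron G h) X') :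
    ‖X - X'‖ ≤ centerErrorConst Lf p * ‖z - z'‖ := by
  have hshift : p • (z - z') - gradProxLag f A b ρ p X z' y = -gradProxLag f A b ρ p X z y := by
    simp only [gradProxLag, smul_sub]
    abel
  have h := mul_norm_sub_le_of_mem_normalCone (hshift ▸ hX) hX'
    (gradProxLag_strongly_monotone hf hρ hX.1 hX'.1)
  rw [norm_smul, Real.norm_of_nonneg hp] at h
  rwa [centerErrorConst, div_mul_eq_mul_div, le_div_iff₀' (sub_pos.2 hpLf)]

theorem add_mulV_transpose_mem_normalCone {d : Vec m} {q u : Vec n}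
    (hq : q ∈ normalCone (feasibleSet A d G h) u) (w : Vec m) :
    q + mulV A.transpose w ∈ normalCone (feasibleSet A d G h) u := by
  refine ⟨hq.1, fun v hv => ?_⟩
  have hker : mulV A (v - u) = 0 := by rw [mulV_sub, hv.2, hq.1.2, sub_self]
  rw [inner_add_left, real_inner_comm (v - u) (mulV _ _), ← inner_mulV, hker, inner_zero_left,
    add_zero]
  exact hq.2 v hv

theorem sub_inv_smul_gradient_sub_mem_normalCone (hp : 0 < p) {d y : Vec m} {X z : Vec n}
    (hX : -gradProxLag f A b ρ p X z y ∈ normalCone (feasibleSet A d G h) X) :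
    z - p⁻¹ • gradient f X - X ∈ normalCone (feasibleSet A d G h) X := by
  convert smul_mem_normalCone (inv_nonneg.2 hp.le)
    (add_mulV_transpose_mem_normalCone hX (y + ρ • (mulV A X - b))) using 1
  simp only [gradProxLag, neg_add, smul_add, smul_neg, inv_smul_smul₀ hp.ne']
  abel

theorem norm_sub_le_dualErrorConst_mul (hf : LSmoothOn f (polyhedron G h) Lf) (hp : 0 < p)
    (hpLf : Lf < p) {C : ℝ} (hC : IsSliceLipschitz A G C) {X Y z : Vec n} {y : Vec m}
    (hX : -gradProxLag f A b ρ p X z y ∈ normalCone (polyhedron G h) X)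
    (hY : -gradProxLag f A b ρ p Y z y ∈ normalCone (feasibleSet A b G h) Y) :
    ‖X - Y‖ ≤ dualErrorConst Lf p C * ‖mulV A X - b‖ := by
  have hXd := sub_inv_smul_gradient_sub_mem_normalCone hp
    (normalCone_anti (feasibleSet_subset_polyhedron A (mulV A X) G h) ⟨hX.1, rfl⟩ hX)
  have hYb := sub_inv_smul_gradient_sub_mem_normalCone hp hY
  obtain ⟨W, hW⟩ := exists_sub_mem_normalCone ⟨Y, hY.1⟩ (isClosed_feasibleSet A b G h)
    (convex_feasibleSet A b G h) (z - p⁻¹ • gradient f X)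
  have hXW : ‖X - W‖ ≤ C * ‖mulV A X - b‖ := hC h b (mulV A X) _ W X hW hXd
  have hWY : ‖W - Y‖ ≤ p⁻¹ * (Lf * ‖X - Y‖) := by
    refine (norm_sub_le_of_sub_mem_normalCone hW hYb).trans ?_
    rw [sub_sub_sub_cancel_left, ← smul_sub, norm_smul, norm_sub_rev,
      Real.norm_of_nonneg (inv_nonneg.2 hp.le)]
    exact mul_le_mul_of_nonneg_left (hf.norm_gradient_sub_le X hX.1 Y hY.1.1)
      (inv_nonneg.2 hp.le)
  have hXY : p * ‖X - Y‖ ≤ p * (C * ‖mulV A X - b‖) + Lf * ‖X - Y‖ := by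
    have := mul_le_mul_of_nonneg_left
      ((norm_sub_le_norm_sub_add_norm_sub X W Y).trans (add_le_add hXW hWY)) hp.le
    rwa [mul_add, mul_inv_cancel_left₀ hp.ne'] at this
  rw [dualErrorConst, div_mul_eq_mul_div, le_div_iff₀' (sub_pos.2 hpLf)]
  linarith

end ErrorBounds

section Stationarity

variable {n m l : ℕ} {f : Vec n → ℝ} {A : Matrix (Fin m) (Fin n) ℝ} {b : Vec m}
  {G : Matrix (Fin l) (Fin n) ℝ} {h : Vec l} {x : Vec n} {y : Vec m}

theorem mem_subdiff_indicatorFn {S : Set (Vec n)} {w : Vec n} :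
    w ∈ subdiff (indicatorFn S) x ↔ w ∈ normalCone S x := by
  by_cases hx : x ∈ S
  · have hu (u : Vec n) : indicatorFn S x + (inner ℝ w (u - x) : ℝ) ≤ indicatorFn S u ↔
        (u ∈ S → inner ℝ w (u - x) ≤ 0) := by
      by_cases hu : u ∈ S
      · simp only [indicatorFn, hx, hu, if_true, zero_add, true_imp_iff]
        exact_mod_cast Iff.rfl
      · simp [indicatorFn, hu]
    simp only [subdiff, normalCone, Set.mem_ofPred_eq, hu, hx, true_and, and_iff_right_iff_imp]
    exact fun _ => by simp [indicatorFn, hx]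
  · simp [subdiff, normalCone, indicatorFn, hx]

theorem isEpsStationary_iff {ε : ℝ} :
    IsEpsStationary f A b G h ε x y ↔ ‖mulV A x - b‖ ≤ ε ∧
      ∃ w ∈ normalCone (polyhedron G h) x, ‖gradient f x + mulV A.transpose y + w‖ ≤ ε := by
  simp only [IsEpsStationary, mem_subdiff_indicatorFn]

theorem IsEpsStationary.mono {ε ε' : ℝ} (hxy : IsEpsStationary f A b G h ε x y) (hε : ε ≤ ε') :
    IsEpsStationary f A b G h ε' x y := by
  obtain ⟨hres, w, hw, hgrad⟩ := hxy
  exact ⟨hres.trans hε, w, hw, hgrad.trans hε⟩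

theorem exists_isEpsStationary (f : Vec n → ℝ) (A : Matrix (Fin m) (Fin n) ℝ) (b : Vec m)
    (hx : x ∈ polyhedron G h) (y : Vec m) : ∃ ε, IsEpsStationary f A b G h ε x y :=
  ⟨max ‖mulV A x - b‖ ‖gradient f x + mulV A.transpose y + 0‖,
    isEpsStationary_iff.2 ⟨le_max_left _ _, 0, ⟨hx, by simp⟩, le_max_right _ _⟩⟩

end Stationarity

section Step

variable {n m l : ℕ} {f : Vec n → ℝ} {A : Matrix (Fin m) (Fin n) ℝ} {b : Vec m}
  {G : Matrix (Fin l) (Fin n) ℝ} {h : Vec l} {Lf ρ p c α β C : ℝ}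
  {x z x' z' X X' Y : Vec n} {y y' : Vec m}

/-- One iteration `(x, y, z) ↦ (x', y', z')` of the S-prox-ALM, with the projection onto `P`
characterized by the normal cone. -/
structure IsStep (f : Vec n → ℝ) (A : Matrix (Fin m) (Fin n) ℝ) (b : Vec m)
    (G : Matrix (Fin l) (Fin n) ℝ) (h : Vec l) (ρ p c α β : ℝ)
    (x : Vec n) (y : Vec m) (z x' : Vec n) (y' : Vec m) (z' : Vec n) : Prop where
  dual_eq : y' = y + α • (mulV A x - b)
  primal_mem : x - c • gradProxLag f A b ρ p x z y' - x' ∈ normalCone (polyhedron G h) x'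
  center_eq : z' = z + β • (x' - z)

/-- Step sizes small enough for the terms of the potential that may increase to be absorbed by
the decreasing ones; `C` is a Lipschitz constant of the projections onto the slices
`{x ∈ P | A x = d}`. -/
structure IsAdmissible (A : Matrix (Fin m) (Fin n) ℝ) (Lf ρ p c C α β : ℝ) : Prop where
  dual_pos : 0 < α
  center_pos : 0 < β
  center_le_one : β ≤ 1
  primal_bound : α * (sigmaMax A ^ 2 * (1 + primalErrorConst A Lf ρ p c) ^ 2) ≤ 1 / (8 * c)
  center_bound : 16 * centerErrorConst Lf p * β ≤ 1
  dual_bound : 8 * p * dualErrorConst Lf p C ^ 2 * β ≤ α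

theorem exists_isAdmissible (A : Matrix (Fin m) (Fin n) ℝ) (hLf : 0 ≤ Lf) (hp : Lf < p)
    (hc : 0 < c) (C : ℝ) :
    ∃ α' > 0, ∃ θ > 0, ∀ α β : ℝ, 0 < α → α < α' → 0 < β → β < θ * α →
      IsAdmissible A Lf ρ p c C α β := by
  have hp₀ : 0 < p := hLf.trans_lt hp
  have hσ₁ : 0 ≤ centerErrorConst Lf p := div_nonneg hp₀.le (sub_pos.2 hp).le
  set s := sigmaMax A ^ 2 * (1 + primalErrorConst A Lf ρ p c) ^ 2
  set σ₁ := centerErrorConst Lf p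
  set τ := dualErrorConst Lf p C
  set α' := 1 / (8 * c * (s + 1))
  have : 0 ≤ s := by positivity
  have hα' : 0 < α' := by positivity
  refine ⟨α', hα', min (1 / (8 * p * τ ^ 2 + 1)) (1 / (α' * (16 * σ₁ + 1))),
    lt_min (by positivity) (by positivity), fun α β hα hαlt hβ hβlt => ?_⟩
  have hprimal : α * s ≤ 1 / (8 * c) := by
    rw [lt_div_iff₀ (by positivity)] at hαlt
    rw [le_div_iff₀ (by positivity)]
    have : 0 ≤ α * (8 * c) := by positivity
    linarith
  have hcenter : β * (16 * σ₁ + 1) ≤ 1 := by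
    have hβα' : β < 1 / (α' * (16 * σ₁ + 1)) * α' := hβlt.trans_le
      (mul_le_mul (min_le_right _ _) hαlt.le hα.le (by positivity))
    rw [one_div, mul_inv_rev, inv_mul_cancel_right₀ hα'.ne', ← one_div,
      lt_div_iff₀ (by positivity)] at hβα'
    exact hβα'.le
  have hdual : (8 * p * τ ^ 2 + 1) * β ≤ α := by
    have hβα : β < 1 / (8 * p * τ ^ 2 + 1) * α := hβlt.trans_le
      (mul_le_mul_of_nonneg_right (min_le_left _ _) hα.le)
    rw [one_div, ← div_eq_inv_mul, lt_div_iff₀' (by positivity)] at hβα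
    exact hβα.le
  have hσ₁β : 0 ≤ β * σ₁ := by positivity
  exact ⟨hα, hβ, by linarith, hprimal, by linarith, by linarith⟩

theorem IsStep.proxLag_le (hst : IsStep f A b G h ρ p c α β x y z x' y' z')
    (hf : LSmoothOn f (polyhedron G h) Lf) (hρ : 0 ≤ ρ) (hc : 0 < c)
    (hcL : Lf + ρ * sigmaMax A ^ 2 + p ≤ 1 / c) (hx : x ∈ polyhedron G h) :
    proxLag f A b ρ p x' z' y' ≤ proxLag f A b ρ p x z y + α * ‖mulV A x - b‖ ^ 2
      - 1 / (2 * c) * ‖x - x'‖ ^ 2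
      + p / 2 * (β ^ 2 * ‖x' - z‖ ^ 2 - 2 * β * ‖x' - z‖ ^ 2) := by
  have hprimal := le_sub_of_gradient_step (F := fun u => proxLag f A b ρ p u z y') hc hcL hx
    hst.primal_mem (proxLag_upper_bound hf hρ hx hst.primal_mem.1)
  have hdual : proxLag f A b ρ p x z y' = proxLag f A b ρ p x z y + α * ‖mulV A x - b‖ ^ 2 := by
    rw [hst.dual_eq, proxLag_add_dual, real_inner_smul_left, real_inner_self_eq_norm_sq]
  rw [hst.center_eq, proxLag_add_center, real_inner_self_eq_norm_sq]
  linarith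

theorem IsStep.le_dualFn (hst : IsStep f A b G h ρ p c α β x y z x' y' z')
    (hf : LSmoothOn f (polyhedron G h) Lf) (hρ : 0 ≤ ρ) (hp : Lf < p)
    (hX : -gradProxLag f A b ρ p X z y' ∈ normalCone (polyhedron G h) X)
    (hX' : -gradProxLag f A b ρ p X' z' y' ∈ normalCone (polyhedron G h) X') :
    dualFn f A b G h ρ p y z + α * inner ℝ (mulV A x - b) (mulV A X - b)
      + p / 2 * (β ^ 2 * ‖x' - z‖ ^ 2 - 2 * β * inner ℝ (x' - z) (X' - z))
      ≤ dualFn f A b G h ρ p y' z' := by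
  have hdual := dualFn_le (A := A) (b := b) (z := z) (y := y) hf hρ hp hX.1
  have hcenter := dualFn_le (A := A) (b := b) (z := z) (y := y') hf hρ hp hX'.1
  have hXy' : proxLag f A b ρ p X z y' =
      proxLag f A b ρ p X z y + α * inner ℝ (mulV A x - b) (mulV A X - b) := by
    rw [hst.dual_eq, proxLag_add_dual, real_inner_smul_left]
  rw [dualFn_eq hf hρ hp.le hX, hXy'] at hcenter
  rw [dualFn_eq hf hρ hp.le hX', hst.center_eq, proxLag_add_center]
  linarith

theorem IsStep.proxFn_le (hst : IsStep f A b G h ρ p c α β x y z x' y' z')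
    (hf : LSmoothOn f (polyhedron G h) Lf) (hρ : 0 ≤ ρ) (hp : Lf < p)
    (hY : -gradProxLag f A b ρ p Y z y' ∈ normalCone (feasibleSet A b G h) Y) :
    proxFn f A b G h p z' ≤ proxFn f A b G h p z
      + p / 2 * (β ^ 2 * ‖x' - z‖ ^ 2 - 2 * β * inner ℝ (x' - z) (Y - z)) := by
  rw [proxFn_eq hf hρ hp.le hY, ← proxLag_add_center, ← hst.center_eq]
  exact SProxALM.proxFn_le hf hρ hp hY.1

-- The square is completed around `A X - b`, the residual at the minimizer, which stands for the
-- gradient of the dual function; this is the term driven to zero by the dual step.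
theorem IsAdmissible.dual_increase_le (hadm : IsAdmissible A Lf ρ p c C α β)
    (hxX : ‖x' - X‖ ≤ primalErrorConst A Lf ρ p c * ‖x - x'‖) :
    α * ‖mulV A x - b‖ ^ 2 - 2 * α * inner ℝ (mulV A x - b) (mulV A X - b)
      ≤ 1 / (8 * c) * ‖x - x'‖ ^ 2 - α * ‖mulV A X - b‖ ^ 2 := by
  set σ := primalErrorConst A Lf ρ p c
  have hdist : ‖x - X‖ ≤ (1 + σ) * ‖x - x'‖ := by
    linarith [norm_sub_le_norm_sub_add_norm_sub x x' X]
  have hsq : α * ‖mulV A (x - X)‖ ^ 2 ≤ 1 / (8 * c) * ‖x - x'‖ ^ 2 := by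
    calc α * ‖mulV A (x - X)‖ ^ 2
        ≤ α * (sigmaMax A ^ 2 * ((1 + σ) * ‖x - x'‖) ^ 2) := by
          refine mul_le_mul_of_nonneg_left ((norm_sq_mulV_le A _).trans ?_) hadm.dual_pos.le
          gcongr
      _ = α * (sigmaMax A ^ 2 * (1 + σ) ^ 2) * ‖x - x'‖ ^ 2 := by ring
      _ ≤ 1 / (8 * c) * ‖x - x'‖ ^ 2 :=
          mul_le_mul_of_nonneg_right hadm.primal_bound (sq_nonneg _)
  have hexpand := norm_sub_sq_real (mulV A x - b) (mulV A X - b)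
  rw [sub_sub_sub_cancel_right, ← mulV_sub] at hexpand
  rw [hexpand] at hsq
  linarith

theorem IsAdmissible.center_increase_le (hadm : IsAdmissible A Lf ρ p c C α β) (hp : 0 < p)
    (e r : ℝ) :
    2 * p * β * (e * (centerErrorConst Lf p * (β * e) + dualErrorConst Lf p C * r))
      ≤ 3 * (p * β) / 8 * e ^ 2 + α / 2 * r ^ 2 := by
  have hpβ : 0 < p * β := mul_pos hp hadm.center_pos
  have hcenter := mul_le_mul_of_nonneg_right hadm.center_bound (mul_nonneg hpβ.le (sq_nonneg e))
  have hdual := mul_le_mul_of_nonneg_right hadm.dual_bound (sq_nonneg r)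
  have hyoung := mul_nonneg hpβ.le (sq_nonneg (e / 2 - 2 * dualErrorConst Lf p C * r))
  linarith

theorem IsStep.inner_sub_le (hst : IsStep f A b G h ρ p c α β x y z x' y' z')
    (hf : LSmoothOn f (polyhedron G h) Lf) (hρ : 0 ≤ ρ) (hp₀ : 0 < p) (hp : Lf < p) (hβ : 0 ≤ β)
    (hC : IsSliceLipschitz A G C)
    (hX : -gradProxLag f A b ρ p X z y' ∈ normalCone (polyhedron G h) X)
    (hX' : -gradProxLag f A b ρ p X' z' y' ∈ normalCone (polyhedron G h) X')
    (hY : -gradProxLag f A b ρ p Y z y' ∈ normalCone (feasibleSet A b G h) Y) :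
    inner ℝ (x' - z) (X' - Y) ≤ ‖x' - z‖ * (centerErrorConst Lf p * (β * ‖x' - z‖)
      + dualErrorConst Lf p C * ‖mulV A X - b‖) := by
  refine (real_inner_le_norm _ _).trans (mul_le_mul_of_nonneg_left ?_ (norm_nonneg _))
  have hzz' : ‖z' - z‖ = β * ‖x' - z‖ := by
    rw [hst.center_eq, add_sub_cancel_left, norm_smul, Real.norm_of_nonneg hβ]
  rw [← hzz']
  exact (norm_sub_le_norm_sub_add_norm_sub X' X Y).trans (add_le_add
    (norm_sub_le_centerErrorConst_mul hf hρ hp₀.le hp hX' hX)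
    (norm_sub_le_dualErrorConst_mul hf hp₀ hp hC hX hY))

theorem IsStep.potential_descent (hst : IsStep f A b G h ρ p c α β x y z x' y' z')
    (hadm : IsAdmissible A Lf ρ p c C α β) (hf : LSmoothOn f (polyhedron G h) Lf) (hρ : 0 ≤ ρ)
    (hp₀ : 0 < p) (hp : Lf < p) (hC : IsSliceLipschitz A G C) (hc : 0 < c)
    (hcL : Lf + ρ * sigmaMax A ^ 2 + p ≤ 1 / c) (hne : (feasibleSet A b G h).Nonempty)
    (hx : x ∈ polyhedron G h)
    (hX : -gradProxLag f A b ρ p X z y' ∈ normalCone (polyhedron G h) X) :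
    potential f A b G h ρ p x' y' z' + (3 / (8 * c) * ‖x - x'‖ ^ 2
      + p * β / 8 * ‖x' - z‖ ^ 2 + α / 2 * ‖mulV A X - b‖ ^ 2)
      ≤ potential f A b G h ρ p x y z := by
  obtain ⟨X', hX'⟩ := exists_neg_gradProxLag_mem_normalCone (A := A) (b := b) hf hρ hp subset_rfl
    (isClosed_polyhedron G h) (convex_polyhedron G h) ⟨x, hx⟩ z' y'
  obtain ⟨Y, hY⟩ := exists_neg_gradProxLag_mem_normalCone (A := A) (b := b) hf hρ hp
    (feasibleSet_subset_polyhedron A b G h) (isClosed_feasibleSet A b G h)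
    (convex_feasibleSet A b G h) hne z y'
  have hprimal := hst.proxLag_le hf hρ hc hcL hx
  have hdual := hst.le_dualFn hf hρ hp hX hX'
  have hprox := hst.proxFn_le hf hρ hp hY
  have hdualInc := hadm.dual_increase_le (b := b)
    (norm_sub_le_primalErrorConst_mul hf hρ hp₀.le hp hc hx hst.primal_mem hX)
  have hpβ : 0 ≤ 2 * p * β := by
    have := hadm.center_pos
    positivity
  have hcenterInc := (mul_le_mul_of_nonneg_left
    (hst.inner_sub_le hf hρ hp₀ hp hadm.center_pos.le hC hX hX' hY) hpβ).trans
    (hadm.center_increase_le hp₀ _ _)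
  rw [← sub_sub_sub_cancel_right X' Y z, inner_sub_right] at hcenterInc
  have hβsq : p * β ^ 2 * ‖x' - z‖ ^ 2 ≤ p * β * ‖x' - z‖ ^ 2 := by
    gcongr
    exact pow_le_of_le_one hadm.center_pos.le hadm.center_le_one two_ne_zero
  have hhalf : 3 / (8 * c) * ‖x - x'‖ ^ 2 + 1 / (8 * c) * ‖x - x'‖ ^ 2
      = 1 / (2 * c) * ‖x - x'‖ ^ 2 := by
    field_simp
    ring
  rw [potential, potential]
  linarith

theorem lt_potential (hf : LSmoothOn f (polyhedron G h) Lf) (hρ : 0 ≤ ρ) (hp₀ : 0 ≤ p)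
    (hp : Lf < p) (hne : (feasibleSet A b G h).Nonempty) {flow : ℝ}
    (hflow : ∀ u ∈ feasibleSet A b G h, flow < f u) (hx : x ∈ polyhedron G h) :
    flow < potential f A b G h ρ p x y z := by
  obtain ⟨Y, hY⟩ := exists_neg_gradProxLag_mem_normalCone (A := A) (b := b) hf hρ hp
    (feasibleSet_subset_polyhedron A b G h) (isClosed_feasibleSet A b G h)
    (convex_feasibleSet A b G h) hne z y
  have hdx := dualFn_le (A := A) (b := b) (z := z) (y := y) hf hρ hp hx
  have hdY := dualFn_le (A := A) (b := b) (z := z) (y := y) hf hρ hp hY.1.1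
  have hPY := proxFn_eq hf hρ hp.le hY
  have hquad : 0 ≤ p / 2 * ‖Y - z‖ ^ 2 := by positivity
  have hfY := proxLag_eq_of_mulV_eq f ρ p z y hY.1.2
  rw [potential]
  linarith [hflow Y hY.1]

/-- The factor by which the stationarity residual of a step is bounded in terms of
`‖x - x'‖ + ‖x' - z‖ + ‖A X - b‖`. -/
noncomputable def residualConst (A : Matrix (Fin m) (Fin n) ℝ) (Lf ρ p c : ℝ) : ℝ :=
  1 + sigmaMax A * primalErrorConst A Lf ρ p c
    + (Lf + c⁻¹ + p + ρ * sigmaMax A ^ 2 * (1 + primalErrorConst A Lf ρ p c)) + p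
    + ρ * sigmaMax A

/-- The smallest of the coefficients with which the potential decreases in a step. -/
noncomputable def descentConst (p c α β : ℝ) : ℝ :=
  min (3 / (8 * c)) (min (p * β / 8) (α / 2))

/-- The constant `κ` of the complexity bound: the squared stationarity residual of a step is at
most `κ` times the decrease of the potential. -/
noncomputable def rateConst (A : Matrix (Fin m) (Fin n) ℝ) (Lf ρ p c α β : ℝ) : ℝ :=
  3 * residualConst A Lf ρ p c ^ 2 / descentConst p c α β

theorem primalErrorConst_nonneg (A : Matrix (Fin m) (Fin n) ℝ) (hLf : 0 ≤ Lf) (hρ : 0 ≤ ρ)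
    (hp : Lf < p) (hc : 0 < c) : 0 ≤ primalErrorConst A Lf ρ p c := by
  have : 0 < p - Lf := sub_pos.2 hp
  have : 0 < p := hLf.trans_lt hp
  unfold primalErrorConst
  positivity

theorem residualConst_pos (A : Matrix (Fin m) (Fin n) ℝ) (hLf : 0 ≤ Lf) (hρ : 0 ≤ ρ)
    (hp : Lf < p) (hc : 0 < c) : 0 < residualConst A Lf ρ p c := by
  have hσ := primalErrorConst_nonneg A hLf hρ hp hc
  have hs := sigmaMax_nonneg A
  have hp₀ : 0 < p := hLf.trans_lt hp
  unfold residualConst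
  positivity

theorem descentConst_pos (hp : 0 < p) (hc : 0 < c) (hα : 0 < α) (hβ : 0 < β) :
    0 < descentConst p c α β :=
  lt_min (by positivity) (lt_min (by positivity) (by positivity))

theorem rateConst_pos (A : Matrix (Fin m) (Fin n) ℝ) (hLf : 0 ≤ Lf) (hρ : 0 ≤ ρ) (hp : Lf < p)
    (hc : 0 < c) (hα : 0 < α) (hβ : 0 < β) : 0 < rateConst A Lf ρ p c α β := by
  have hM := residualConst_pos A hLf hρ hp hc
  have hδ := descentConst_pos (hLf.trans_lt hp) hc hα hβ
  unfold rateConst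
  positivity

theorem norm_mulV_sub_le (A : Matrix (Fin m) (Fin n) ℝ) (b : Vec m) (x X : Vec n) :
    ‖mulV A x - b‖ ≤ sigmaMax A * ‖x - X‖ + ‖mulV A X - b‖ := by
  refine (norm_sub_le_norm_sub_add_norm_sub _ (mulV A X) _).trans (add_le_add_left ?_ _)
  rw [← mulV_sub]
  exact norm_mulV_le A _

theorem IsStep.exists_mem_normalCone_norm_le (hst : IsStep f A b G h ρ p c α β x y z x' y' z')
    (hf : LSmoothOn f (polyhedron G h) Lf) (hρ : 0 ≤ ρ) (hp : 0 ≤ p) (hc : 0 < c)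
    (hx : x ∈ polyhedron G h) :
    ∃ w ∈ normalCone (polyhedron G h) x', ‖gradient f x' + mulV A.transpose y' + w‖ ≤
      (Lf + c⁻¹ + p) * ‖x - x'‖ + p * ‖x' - z‖ + ρ * (sigmaMax A * ‖mulV A x - b‖) := by
  refine ⟨_, smul_mem_normalCone (inv_nonneg.2 hc.le) hst.primal_mem, ?_⟩
  have hsplit : gradient f x' + mulV A.transpose y'
        + c⁻¹ • (x - c • gradProxLag f A b ρ p x z y' - x')
      = (gradient f x' - gradient f x) + c⁻¹ • (x - x')
        - (p • ((x - x') + (x' - z)) + ρ • mulV A.transpose (mulV A x - b)) := by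
    simp only [gradProxLag, mulV, map_add, map_smul, map_sub, smul_sub, smul_add,
      inv_smul_smul₀ hc.ne']
    abel
  have hgrad : ‖gradient f x' - gradient f x‖ ≤ Lf * ‖x - x'‖ := by
    rw [norm_sub_rev x]
    exact hf.norm_gradient_sub_le x' hst.primal_mem.1 x hx
  have hproj : ‖c⁻¹ • (x - x')‖ = c⁻¹ * ‖x - x'‖ := by
    rw [norm_smul, Real.norm_of_nonneg (inv_nonneg.2 hc.le)]
  have hprox : ‖p • ((x - x') + (x' - z))‖ ≤ p * (‖x - x'‖ + ‖x' - z‖) := by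
    rw [norm_smul, Real.norm_of_nonneg hp]
    exact mul_le_mul_of_nonneg_left (norm_add_le _ _) hp
  have hpenalty : ‖ρ • mulV A.transpose (mulV A x - b)‖ ≤ ρ * (sigmaMax A * ‖mulV A x - b‖) := by
    rw [norm_smul, Real.norm_of_nonneg hρ]
    exact mul_le_mul_of_nonneg_left (norm_mulV_transpose_le A _) hρ
  rw [hsplit]
  refine (norm_sub_le_of_le (norm_add_le_of_le hgrad hproj.le)
    (norm_add_le_of_le hprox hpenalty)).trans_eq ?_
  ring

theorem IsStep.isEpsStationary (hst : IsStep f A b G h ρ p c α β x y z x' y' z')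
    (hf : LSmoothOn f (polyhedron G h) Lf) (hLf : 0 ≤ Lf) (hρ : 0 ≤ ρ) (hp : Lf < p) (hc : 0 < c)
    (hx : x ∈ polyhedron G h)
    (hX : -gradProxLag f A b ρ p X z y' ∈ normalCone (polyhedron G h) X) :
    IsEpsStationary f A b G h
      (residualConst A Lf ρ p c * (‖x - x'‖ + ‖x' - z‖ + ‖mulV A X - b‖)) x' y' := by
  have hp₀ : 0 ≤ p := hLf.trans hp.le
  have hs := sigmaMax_nonneg A
  have hσ := primalErrorConst_nonneg A hLf hρ hp hc
  have hx'X := norm_sub_le_primalErrorConst_mul hf hρ hp₀ hp hc hx hst.primal_mem hX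
  have hxX := norm_sub_le_norm_sub_add_norm_sub x x' X
  obtain ⟨w, hw, hgrad⟩ := hst.exists_mem_normalCone_norm_le hf hρ hp₀ hc hx
  have hfeas := norm_mulV_sub_le A b x' X
  have hres := norm_mulV_sub_le A b x X
  set M := residualConst A Lf ρ p c with hM
  rw [residualConst] at hM
  set s := sigmaMax A
  set σ := primalErrorConst A Lf ρ p c
  set a := ‖x - x'‖
  set e := ‖x' - z‖
  set r := ‖mulV A X - b‖
  have hres' : ‖mulV A x - b‖ ≤ s * ((1 + σ) * a) + r :=
    hres.trans (by gcongr; linarith)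
  have hprimal : 0 ≤ Lf + c⁻¹ + p + ρ * s ^ 2 * (1 + σ) := by positivity
  have hsσ : 0 ≤ s * σ := by positivity
  have hρs : 0 ≤ ρ * s := by positivity
  have hcomb {u v w : ℝ} (hu : u ≤ M) (hv : v ≤ M) (hw : w ≤ M) :
      u * a + v * e + w * r ≤ M * (a + e + r) := by
    rw [mul_add, mul_add]
    gcongr
  refine isEpsStationary_iff.2 ⟨?_, w, hw, ?_⟩
  · calc ‖mulV A x' - b‖ ≤ s * (σ * a) + r := hfeas.trans (by gcongr)
      _ = (s * σ) * a + 0 * e + 1 * r := by ring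
      _ ≤ M * (a + e + r) := hcomb (by linarith) (by linarith) (by linarith)
  · calc ‖gradient f x' + mulV A.transpose y' + w‖
        ≤ (Lf + c⁻¹ + p) * a + p * e + ρ * (s * (s * ((1 + σ) * a) + r)) :=
          hgrad.trans (by gcongr)
      _ = (Lf + c⁻¹ + p + ρ * s ^ 2 * (1 + σ)) * a + p * e + ρ * s * r := by ring
      _ ≤ M * (a + e + r) := hcomb (by linarith) (by linarith) (by linarith)

theorem IsStep.exists_residual (hst : IsStep f A b G h ρ p c α β x y z x' y' z')
    (hadm : IsAdmissible A Lf ρ p c C α β) (hf : LSmoothOn f (polyhedron G h) Lf) (hLf : 0 ≤ Lf)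
    (hρ : 0 ≤ ρ) (hp : Lf < p) (hC : IsSliceLipschitz A G C) (hc : 0 < c)
    (hcL : Lf + ρ * sigmaMax A ^ 2 + p ≤ 1 / c) (hne : (feasibleSet A b G h).Nonempty)
    (hx : x ∈ polyhedron G h) :
    ∃ ε, ε ^ 2 ≤ rateConst A Lf ρ p c α β *
        (potential f A b G h ρ p x y z - potential f A b G h ρ p x' y' z') ∧
      IsEpsStationary f A b G h ε x' y' := by
  have hp₀ : 0 < p := hLf.trans_lt hp
  obtain ⟨X, hX⟩ := exists_neg_gradProxLag_mem_normalCone (A := A) (b := b) hf hρ hp subset_rfl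
    (isClosed_polyhedron G h) (convex_polyhedron G h) ⟨x, hx⟩ z y'
  refine ⟨_, ?_, hst.isEpsStationary hf hLf hρ hp hc hx hX⟩
  have hdesc := hst.potential_descent hadm hf hρ hp₀ hp hC hc hcL hne hx hX
  have hδ := descentConst_pos hp₀ hc hadm.dual_pos hadm.center_pos
  have hκ := rateConst_pos A hLf hρ hp hc hadm.dual_pos hadm.center_pos
  set M := residualConst A Lf ρ p c
  set δ := descentConst p c α β
  set a := ‖x - x'‖
  set e := ‖x' - z‖
  set r := ‖mulV A X - b‖
  have hdecrease : δ * (a ^ 2 + e ^ 2 + r ^ 2)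
      ≤ potential f A b G h ρ p x y z - potential f A b G h ρ p x' y' z' := by
    calc δ * (a ^ 2 + e ^ 2 + r ^ 2) = δ * a ^ 2 + δ * e ^ 2 + δ * r ^ 2 := by ring
      _ ≤ 3 / (8 * c) * a ^ 2 + p * β / 8 * e ^ 2 + α / 2 * r ^ 2 := by
        gcongr
        exacts [min_le_left _ _, (min_le_right _ _).trans (min_le_left _ _),
          (min_le_right _ _).trans (min_le_right _ _)]
      _ ≤ _ := le_sub_iff_add_le'.2 hdesc
  have hcauchy : (a + e + r) ^ 2 ≤ 3 * (a ^ 2 + e ^ 2 + r ^ 2) := by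
    linarith [sq_nonneg (a - e), sq_nonneg (a - r), sq_nonneg (e - r)]
  calc (M * (a + e + r)) ^ 2 = M ^ 2 * (a + e + r) ^ 2 := by ring
    _ ≤ M ^ 2 * (3 * (a ^ 2 + e ^ 2 + r ^ 2)) := by gcongr
    _ = 3 * M ^ 2 / δ * (δ * (a ^ 2 + e ^ 2 + r ^ 2)) := by field_simp
    _ ≤ _ := mul_le_mul_of_nonneg_left hdecrease hκ.le

end Step

section SquareSummable

variable {η : ℕ → ℝ} {B : ℝ}

theorem sum_sq_le_of_le_decrease {Φ : ℕ → ℝ} {κ Φlow : ℝ} (hκ : 0 ≤ κ) (hΦ : ∀ t, Φlow ≤ Φ t)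
    (hη : ∀ t, η t ^ 2 ≤ κ * (Φ t - Φ (t + 1))) (t : ℕ) :
    ∑ s ∈ Finset.range t, η s ^ 2 ≤ κ * (Φ 0 - Φlow) := by
  calc ∑ s ∈ Finset.range t, η s ^ 2
      ≤ ∑ s ∈ Finset.range t, κ * (Φ s - Φ (s + 1)) := Finset.sum_le_sum fun s _ => hη s
    _ = κ * (Φ 0 - Φ t) := by rw [← Finset.mul_sum, Finset.sum_range_sub']
    _ ≤ κ * (Φ 0 - Φlow) := by gcongr; exact hΦ t

theorem exists_lt_le_sqrt_div_sqrt (hsum : ∀ t, ∑ s ∈ Finset.range t, η s ^ 2 ≤ B) {t : ℕ}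
    (ht : 0 < t) : ∃ s < t, η s ≤ √B / √(t : ℝ) := by
  have ht' : (0 : ℝ) < t := Nat.cast_pos.2 ht
  obtain ⟨s, hs, hle⟩ := Finset.exists_le_of_sum_le (s := Finset.range t)
    (f := fun s => η s ^ 2) (g := fun _ => B / t) ⟨0, Finset.mem_range.2 ht⟩ (by
      rw [Finset.sum_const, Finset.card_range, nsmul_eq_mul, mul_div_cancel₀ _ ht'.ne']
      exact hsum t)
  refine ⟨s, Finset.mem_range.1 hs, ?_⟩
  rw [← Real.sqrt_div' B ht'.le]
  exact Real.le_sqrt_of_sq_le hle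

theorem exists_lt_div_sq_le (hsum : ∀ t, ∑ s ∈ Finset.range t, η s ^ 2 ≤ B) (hB : 0 < B) {ε : ℝ}
    (hε : 0 < ε) : ∃ s : ℕ, (s : ℝ) < B / ε ^ 2 ∧ η s ≤ ε := by
  have hceil : 0 < ⌈B / ε ^ 2⌉₊ := Nat.ceil_pos.2 (by positivity)
  obtain ⟨s, hs, hle⟩ := exists_lt_le_sqrt_div_sqrt hsum hceil
  refine ⟨s, Nat.lt_ceil.1 hs, hle.trans ?_⟩
  rw [← Real.sqrt_div' B (Nat.cast_nonneg _)]
  refine Real.sqrt_le_iff.2 ⟨hε.le, ?_⟩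
  rw [div_le_comm₀ (Nat.cast_pos.2 hceil) (by positivity)]
  exact Nat.le_ceil _

theorem tendsto_zero_of_sum_sq_le (hsum : ∀ t, ∑ s ∈ Finset.range t, η s ^ 2 ≤ B) :
    Tendsto η atTop (𝓝 0) := by
  have hsq := (summable_of_sum_range_le (fun s => sq_nonneg (η s)) hsum).tendsto_atTop_zero
  simpa [Real.sqrt_sq_eq_abs, tendsto_zero_iff_abs_tendsto_zero η, Function.comp_def]
    using hsq.sqrt

end SquareSummable

section KKT

variable {n m l : ℕ} {f : Vec n → ℝ} {A : Matrix (Fin m) (Fin n) ℝ} {b : Vec m}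
  {G : Matrix (Fin l) (Fin n) ℝ} {h : Vec l} {Lf : ℝ} {x : ℕ → Vec n} {y : ℕ → Vec m}
  {ε : ℕ → ℝ} {xbar : Vec n} {ybar : Vec m}

theorem isKKTPoint_of_neg_mem_normalCone {x : Vec n} {y : Vec m} (hAx : mulV A x = b)
    (hgrad : -(gradient f x + mulV A.transpose y) ∈ normalCone (polyhedron G h) x) :
    IsKKTPoint f A b G h x y := by
  have hx := hgrad.1
  rw [polyhedron_eq_halfspaces] at hgrad
  obtain ⟨μ, hμ, hsum⟩ :=
    mem_hull_image_finset_iff.1 (mem_hull_of_mem_normalCone_halfspaces hgrad)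
  refine ⟨WithLp.toLp 2 fun i => if inner ℝ (rowV G i) x = h i then μ i else 0, ?_,
    sub_eq_zero.2 hAx, hx, fun i => ?_, fun i => ?_⟩
  · simp only [mulV_transpose_eq_sum G, ite_smul, zero_smul]
    rw [← Finset.sum_filter, hsum, add_neg_cancel]
  · by_cases hi : inner ℝ (rowV G i) x = h i <;> simp [hi, hμ i]
  · by_cases hi : inner ℝ (rowV G i) x = h i
    · rw [← inner_rowV, hi, sub_self, mul_zero]
    · simp [hi]

theorem isKKTPoint_of_tendsto (hf : LSmoothOn f (polyhedron G h) Lf)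
    (hx : Tendsto x atTop (𝓝 xbar)) (hy : Tendsto y atTop (𝓝 ybar)) (hε : Tendsto ε atTop (𝓝 0))
    (hst : ∀ t, IsEpsStationary f A b G h (ε t) (x t) (y t)) :
    IsKKTPoint f A b G h xbar ybar := by
  choose hres w hw hwε using fun t => isEpsStationary_iff.1 (hst t)
  have hbar : xbar ∈ polyhedron G h :=
    (isClosed_polyhedron G h).mem_of_tendsto hx (Eventually.of_forall fun t => (hw t).1)
  have hAx : mulV A xbar = b := by
    have hlim := (((continuous_mulV A).tendsto xbar).comp hx).sub_const b
    exact sub_eq_zero.1 (tendsto_nhds_unique hlim (squeeze_zero_norm hres hε))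
  have hgrad : Tendsto (fun t => gradient f (x t)) atTop (𝓝 (gradient f xbar)) := by
    rw [tendsto_iff_norm_sub_tendsto_zero] at hx ⊢
    refine squeeze_zero (fun _ => norm_nonneg _)
      (fun t => hf.norm_gradient_sub_le _ (hw t).1 _ hbar) ?_
    simpa using hx.const_mul Lf
  have hw_lim : Tendsto w atTop (𝓝 (-(gradient f xbar + mulV A.transpose ybar))) := by
    have hlim := (squeeze_zero_norm hwε hε).sub
      (hgrad.add (((continuous_mulV A.transpose).tendsto ybar).comp hy))
    simpa using hlim
  exact isKKTPoint_of_neg_mem_normalCone hAx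
    (mem_normalCone_of_tendsto (isClosed_polyhedron G h) hx hw_lim hw)

theorem isKKTPoint_of_mapClusterPt (hf : LSmoothOn f (polyhedron G h) Lf)
    (hε : Tendsto ε atTop (𝓝 0))
    (hst : ∀ t, IsEpsStationary f A b G h (ε t) (x (t + 1)) (y (t + 1)))
    (hcl : MapClusterPt (xbar, ybar) atTop fun t => (x t, y t)) :
    IsKKTPoint f A b G h xbar ybar := by
  obtain ⟨ψ, hψ, hlim⟩ := hcl.tendsto_subseq
  have hlim' := hlim.comp (tendsto_add_atTop_nat 1)
  have hψ_pos (t : ℕ) : 1 ≤ ψ (t + 1) := (Nat.le_add_left 1 t).trans hψ.le_apply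
  refine isKKTPoint_of_tendsto hf hlim'.fst_nhds hlim'.snd_nhds
    (hε.comp ((tendsto_sub_atTop_nat 1).comp
      (hψ.tendsto_atTop.comp (tendsto_add_atTop_nat 1)))) fun t => ?_
  have hstep := hst (ψ (t + 1) - 1)
  rwa [Nat.sub_add_cancel (hψ_pos t)] at hstep

end KKT

section Convergence

variable {n m l : ℕ} {f : Vec n → ℝ} {A : Matrix (Fin m) (Fin n) ℝ} {b : Vec m}
  {G : Matrix (Fin l) (Fin n) ℝ} {h : Vec l} {Lf ρ p c α β C flow : ℝ}
  {x : ℕ → Vec n} {y : ℕ → Vec m} {z : ℕ → Vec n}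

theorem IsSProxALM.mem_polyhedron (hseq : IsSProxALM f A b G h ρ p c α β x y z) (t : ℕ) :
    x (t + 1) ∈ polyhedron G h := (hseq.x_step t).1

theorem IsSProxALM.shift (hseq : IsSProxALM f A b G h ρ p c α β x y z) :
    IsSProxALM f A b G h ρ p c α β (fun t => x (t + 1)) (fun t => y (t + 1))
      (fun t => z (t + 1)) :=
  ⟨fun t => hseq.y_step (t + 1), fun t => hseq.x_step (t + 1), fun t => hseq.z_step (t + 1)⟩

theorem IsSProxALM.isStep (hseq : IsSProxALM f A b G h ρ p c α β x y z)
    (hf : ∀ u ∈ polyhedron G h, DifferentiableAt ℝ f u) {t : ℕ} (hx : x t ∈ polyhedron G h) :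
    IsStep f A b G h ρ p c α β (x t) (y t) (z t) (x (t + 1)) (y (t + 1)) (z (t + 1)) where
  dual_eq := hseq.y_step t
  primal_mem := by
    obtain ⟨hmem, hmin⟩ := hseq.x_step t
    rw [(hasGradientAt_proxLag A b ρ p (z t) (y (t + 1)) (hf _ hx)).gradient] at hmin
    exact sub_mem_normalCone_of_forall_norm_le (convex_polyhedron G h) hmem hmin
  center_eq := hseq.z_step t

theorem IsSProxALM.exists_residuals_of_mem (hseq : IsSProxALM f A b G h ρ p c α β x y z)
    (hadm : IsAdmissible A Lf ρ p c C α β) (hf : LSmoothOn f (polyhedron G h) Lf) (hLf : 0 ≤ Lf)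
    (hρ : 0 ≤ ρ) (hp : Lf < p) (hC : IsSliceLipschitz A G C) (hc : 0 < c)
    (hcL : Lf + ρ * sigmaMax A ^ 2 + p ≤ 1 / c) (hne : (feasibleSet A b G h).Nonempty)
    (hflow : ∀ u ∈ feasibleSet A b G h, flow < f u) (hx : x 0 ∈ polyhedron G h) :
    ∃ η : ℕ → ℝ, (∀ s, IsEpsStationary f A b G h (η s) (x (s + 1)) (y (s + 1))) ∧
      ∀ t, ∑ s ∈ Finset.range t, η s ^ 2 ≤
        rateConst A Lf ρ p c α β * (potential f A b G h ρ p (x 0) (y 0) (z 0) - flow) := by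
  have hmem : ∀ t, x t ∈ polyhedron G h
    | 0 => hx
    | t + 1 => hseq.mem_polyhedron t
  choose η hη hst using fun t => (hseq.isStep hf.differentiableAt (hmem t)).exists_residual
    hadm hf hLf hρ hp hC hc hcL hne (hmem t)
  exact ⟨η, hst, sum_sq_le_of_le_decrease
    (Φ := fun t => potential f A b G h ρ p (x t) (y t) (z t))
    (rateConst_pos A hLf hρ hp hc hadm.dual_pos hadm.center_pos).le
    (fun t => (lt_potential hf hρ (hLf.trans hp.le) hp hne hflow (hmem t)).le) hη⟩

-- When `x 0` lies outside `P`, the descent argument starts at `x 1`; the residual of the first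
-- step is finite but not controlled by the potential.
theorem IsSProxALM.exists_residuals (hseq : IsSProxALM f A b G h ρ p c α β x y z)
    (hadm : IsAdmissible A Lf ρ p c C α β) (hf : LSmoothOn f (polyhedron G h) Lf) (hLf : 0 ≤ Lf)
    (hρ : 0 ≤ ρ) (hp : Lf < p) (hC : IsSliceLipschitz A G C) (hc : 0 < c)
    (hcL : Lf + ρ * sigmaMax A ^ 2 + p ≤ 1 / c) (hne : (feasibleSet A b G h).Nonempty)
    (hflow : ∀ u ∈ feasibleSet A b G h, flow < f u) :
    ∃ B > 0, (x 0 ∈ polyhedron G h →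
        B = rateConst A Lf ρ p c α β * (potential f A b G h ρ p (x 0) (y 0) (z 0) - flow)) ∧
      ∃ η : ℕ → ℝ, (∀ s, IsEpsStationary f A b G h (η s) (x (s + 1)) (y (s + 1))) ∧
        ∀ t, ∑ s ∈ Finset.range t, η s ^ 2 ≤ B := by
  have hκ := rateConst_pos A hLf hρ hp hc hadm.dual_pos hadm.center_pos
  have hlow {u : Vec n} (hu : u ∈ polyhedron G h) (v : Vec m) (w : Vec n) :=
    mul_pos hκ (sub_pos.2 (lt_potential (y := v) (z := w) hf hρ (hLf.trans hp.le) hp hne hflow hu))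
  by_cases hx : x 0 ∈ polyhedron G h
  · exact ⟨_, hlow hx (y 0) (z 0), fun _ => rfl,
      hseq.exists_residuals_of_mem hadm hf hLf hρ hp hC hc hcL hne hflow hx⟩
  · obtain ⟨η, hst, hsum⟩ := hseq.shift.exists_residuals_of_mem hadm hf hLf hρ hp hC hc hcL hne
      hflow (hseq.mem_polyhedron 0)
    obtain ⟨ε₀, hε₀⟩ := exists_isEpsStationary f A b (hseq.mem_polyhedron 0) (y 1)
    have hB := hlow (hseq.mem_polyhedron 0) (y 1) (z 1)
    refine ⟨_, add_pos_of_pos_of_nonneg hB (sq_nonneg ε₀), fun h₀ => absurd h₀ hx,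
      fun t => Nat.casesOn t ε₀ η, fun s => by cases s; exacts [hε₀, hst _], fun t => ?_⟩
    cases t with
    | zero => simpa using (add_pos_of_pos_of_nonneg hB (sq_nonneg ε₀)).le
    | succ t =>
      rw [Finset.sum_range_succ']
      exact add_le_add_left (hsum t) _

end Convergence

end SProxALM

open SProxALM in
theorem theorem2p4_general {n m l : ℕ}
    (A : Matrix (Fin m) (Fin n) ℝ) (G : Matrix (Fin l) (Fin n) ℝ)
    (Lf p ρ c : ℝ) (hLf : 0 ≤ Lf) (hpLf : Lf < p) (hρ : 0 ≤ ρ)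
    (hc : 0 < c) (hc' : c ≤ 1 / (Lf + ρ * sigmaMax A ^ 2 + p)) :
    ∃ α' > 0, ∃ θ > 0, ∀ α β : ℝ, 0 < α → α < α' → 0 < β → β < θ * α →
      ∃ κ > 0, ∀ (b : Vec m) (h : Vec l) (f : Vec n → ℝ) (flow : ℝ),
        LSmoothOn f (polyhedron G h) Lf →
        (feasibleSet A b G h).Nonempty →
        (∀ u ∈ feasibleSet A b G h, flow < f u) →
        ∀ (x : ℕ → Vec n) (y : ℕ → Vec m) (z : ℕ → Vec n),
          IsSProxALM f A b G h ρ p c α β x y z →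
          (∀ (xbar : Vec n) (ybar : Vec m),
            MapClusterPt (xbar, ybar) atTop (fun t => (x t, y t)) →
            IsKKTPoint f A b G h xbar ybar) ∧
          (∃ B > 0,
            (x 0 ∈ polyhedron G h →
              B = κ * (potential f A b G h ρ p (x 0) (y 0) (z 0) - flow)) ∧
            (∀ t : ℕ, 0 < t → ∃ s < t,
              IsEpsStationary f A b G h (√B / √(t : ℝ)) (x (s + 1)) (y (s + 1))) ∧
            (∀ ε : ℝ, 0 < ε → ∃ s : ℕ, (s : ℝ) < B / ε ^ 2 ∧
              IsEpsStationary f A b G h ε (x (s + 1)) (y (s + 1)))) := by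
  obtain ⟨C, hC⟩ := exists_isSliceLipschitz A G
  obtain ⟨α', hα', θ, hθ, hadm⟩ := exists_isAdmissible (ρ := ρ) A hLf hpLf hc C
  have hp₀ : 0 < p := hLf.trans_lt hpLf
  have hcL : Lf + ρ * sigmaMax A ^ 2 + p ≤ 1 / c := (le_one_div hc (by positivity)).1 hc'
  refine ⟨α', hα', θ, hθ, fun α β hα hαα' hβ hβθ => ?_⟩
  refine ⟨rateConst A Lf ρ p c α β, rateConst_pos A hLf hρ hpLf hc hα hβ,
    fun b h f flow hf hne hflow x y z hseq => ?_⟩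
  obtain ⟨B, hB, hBκ, η, hst, hsum⟩ := hseq.exists_residuals (hadm α β hα hαα' hβ hβθ)
    hf hLf hρ hpLf hC hc hcL hne hflow
  refine ⟨fun xbar ybar => isKKTPoint_of_mapClusterPt hf (tendsto_zero_of_sum_sq_le hsum) hst,
    B, hB, hBκ, fun t ht => ?_, fun ε hε => ?_⟩
  · obtain ⟨s, hs, hle⟩ := exists_lt_le_sqrt_div_sqrt hsum ht
    exact ⟨s, hs, (hst s).mono hle⟩
  · obtain ⟨s, hs, hle⟩ := exists_lt_div_sq_le hsum hB hε
    exact ⟨s, hs, (hst s).mono hle⟩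

theorem theorem2p4 {n m l : ℕ}
    (A : Matrix (Fin m) (Fin n) ℝ) (G : Matrix (Fin l) (Fin n) ℝ)
    (Lf p ρ c : ℝ) (hLf : 0 ≤ Lf) (hpLf : Lf < p) (hp : 3 * Lf ≤ p) (hρ : 0 ≤ ρ)
    (hc : 0 < c) (hc' : c < 1 / (Lf + ρ * SProxALM.sigmaMax A ^ 2 + p)) :
    -- thresholds depending only on `Lf, A, G, p, ρ, c`: `α < α'` and `β < β' = θ * α`
    ∃ α' > 0, ∃ θ > 0, ∀ α β : ℝ, 0 < α → α < α' → 0 < β → β < θ * α →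
      -- `κ` depends only on `p, ρ, c, α, β, Lf, A, G`
      ∃ κ > 0, ∀ (b : SProxALM.Vec m) (h : SProxALM.Vec l) (f : SProxALM.Vec n → ℝ) (flow : ℝ),
        Differentiable ℝ f →
        (∀ u ∈ SProxALM.polyhedron G h, ∀ u' ∈ SProxALM.polyhedron G h,
          ‖gradient f u - gradient f u'‖ ≤ Lf * ‖u - u'‖) →
        (SProxALM.feasibleSet A b G h).Nonempty →
        (∀ u ∈ SProxALM.feasibleSet A b G h, flow < f u) →
        ∀ (x : ℕ → SProxALM.Vec n) (y : ℕ → SProxALM.Vec m) (z : ℕ → SProxALM.Vec n),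
          SProxALM.IsSProxALM f A b G h ρ p c α β x y z →
          (∀ (xbar : SProxALM.Vec n) (ybar : SProxALM.Vec m),
            MapClusterPt (xbar, ybar) atTop (fun t => (x t, y t)) →
            SProxALM.IsKKTPoint f A b G h xbar ybar) ∧
          (∃ B > 0,
            (x 0 ∈ SProxALM.polyhedron G h →
              B = κ * (SProxALM.potential f A b G h ρ p (x 0) (y 0) (z 0) - flow)) ∧
            (∀ t : ℕ, 0 < t → ∃ s < t,
              SProxALM.IsEpsStationary f A b G h (√B / √(t : ℝ)) (x (s + 1)) (y (s + 1))) ∧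
            (∀ ε : ℝ, 0 < ε → ∃ s : ℕ, (s : ℝ) < B / ε ^ 2 ∧
              SProxALM.IsEpsStationary f A b G h ε (x (s + 1)) (y (s + 1)))) := by
  obtain ⟨α', hα', θ, hθ, hmain⟩ := theorem2p4_general A G Lf p ρ c hLf hpLf hρ hc hc'.le
  refine ⟨α', hα', θ, hθ, fun α β hα hαα' hβ hβθ => ?_⟩
  obtain ⟨κ, hκ, hmain⟩ := hmain α β hα hαα' hβ hβθ
  exact ⟨κ, hκ, fun b h f flow hf hL => hmain b h f flow ⟨fun u _ => hf u, hL⟩⟩
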